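/- Let $n\ge 4$, $m\ge 1$ and $i\in\{1,2\}$. **Polytope model.** Let $B^{i,m}$ be the set of arrays $A=(a_{p,q})_{1\le p\le i\le q\le n}$ of non-negative integers such that $\sum_{r=1}^n a_{\beta(r)}\le m$ for every Dyck path $\beta$, i.e. every sequence $\beta(1)=(1,i),\dots,\beta(n)=(i,n)$ whose steps are $(a,b)\mapsto(a,b+1)$ or $(a,b)\mapsto(a+1,b)$. Put $a_{p,q}=0$ for all other $p,q$. It carries Kus's affine crystal structure of type $A_n^{(1)}$, with operators $e_\ell,f_\ell$ $(0\le \ell\le n)$: $f_0$ lowers $a_{1,n}$ by $1$ (when $a_{1,n}>0$); $f_i$ raises $a_{i,i}$ by $1$ (when $m-\sum_{j<i}a_{j,i}-\sum_{j=i}^n a_{i,j}>0$); for $\ell>i$, $f_\ell$ moves one unit from $a_{p,\ell-1}$ to $a_{p,\ell}$, where $p$ is the least maximizer over $1\le p\le i$ of $\sum_{j\le p}a_{j,\ell-1}+\sum_{j=p}^{i}a_{j,\ell}$ (when $\sum_{j\le p}a_{j,\ell-1}-\sum_{j<p}a_{j,\ell}>0$); for $1\le \ell<i$, $f_\ell$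 moves one unit from $a_{\ell+1,p}$ to $a_{\ell,p}$, where $p$ is the greatest maximizer over $i\le p\le n$ of $\sum_{j=i}^{p}a_{\ell,j}+\sum_{j=p}^{n}a_{\ell+1,j}$ (when $\sum_{j\ge p}a_{\ell+1,j}-\sum_{j>p}a_{\ell,j}>0$); otherwise $f_\ell(A)=0$; and $e_\ell$ is the partial inverse of $f_\ell$. **Tableau model.** Let $\mathrm{SSYT}(m\omega_i)$ be the set of semistandard tableaux with $i$ rows of length $m$ and entries in $\{1,\dots,n+1\}$, with its Kirillov–Reshetikhin crystal structure: for $1\le j\le n$, $e_j,f_j$ are given by the signature rule on the word obtained by reading the rows from bottom to top, each from left to right (successively pair each $j+1$ with the nearest unpaired $j$ to its right; $f_j$ changes the rightmost unpaired $j$ to $j+1$, $e_j$ changes the leftmost unpaired $j+1$ to $j$, and the result is $0$ if there is none), and $e_0=\mathrm{pr}^{-1}e_1\mathrm{pr}$, $f_0=\mathrm{pr}^{-1}f_1\mathrm{pr}$ with $\mathrm{pr}$ the Schützenberger promotion. Let $T^{(0)}$ be the tableau whose $j$-th row consists of $m$ entries $j$. For a tableau $T$, let $T_{st}$ $(1\le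 s\le i,\ 1\le t\le n+2-i)$ be the multiplicity of $s+t-1$ in its $s$-th row. **Paths and statistics.** For $A\in B^{i,m}$ and $2\le\ell\le n$ define $$X(i)_\ell^A:=\Big(\prod_{j=i+1}^{\ell} f_{\ell+i+1-j}^{\sum_{p=1}^i a_{p,\ell}}\Big)\Big(\prod_{j=2}^i f_j^{\sum_{p=2}^j a_{p,\ell}}\Big),\qquad G(i)^A:=\prod_{p=1}^i f_p^{\sum_{r=i}^n a_{1,r}},$$ where $\prod_{j=s}^t F_j:=F_sF_{s+1}\cdots F_t$ is a composition of operators (the identity if $s>t$). Define $\Sigma_n:=-a_{2,n}$, $\chi_n:=1$, and by downward recursion, for $2\le k<n$, $$\Sigma_k:=a_{1,k+1}+(1-\chi_{k+1})\Sigma_{k+1}-a_{2,k},\qquad \chi_k:=1\text{ if }\Sigma_k<0,\quad \chi_k:=0\text{ if }\Sigma_k\ge 0.$$ **Theorem.** For every $A\in B^{i,m}$ and every $k=2,\dots,n$, the element $$T^{(k)}:=X(i)_k^AX(i)_{k+1}^A\cdots X(i)_n^A\,G(i)^A(T^{(0)})$$ is non-zero, hence a tableau in $\mathrm{SSYT}(m\omega_i)$,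 and for $1\le s\le i$, $1\le t\le n+2-i$, $$T^{(k)}_{st}=\begin{cases} m-\sum_{j=i}^na_{1,j}& \text{if } (s,t)=(i-1,1),\\ \sum_{j=2}^{k} a_{1,j} + (1-\chi_{k})\Sigma_{k} & \text{if } (s,t)=(i-1,2),\\ m - \sum_{j=i}^{n} a_{1,j} + \sum_{j=k}^{n} \chi_j\Sigma_j & \text{if } (s,t)=(i,1),\\ \sum_{j=i}^{k-1} a_{1,j} & \text{if } (s,t)=(i,2)\text{ and }k>i,\\ a_{2,t-1} + \chi_{t-1}\Sigma_{t-1} & \text{if } s=i-1 \text{ and } k+1\le t \le n,\\ a_{1,t+i-2} - \chi_{t+i-2}\Sigma_{t+i-2} & \text{if } s=i \text{ and } k-i+2\le t\le n-i+2,\\ 0&\text{otherwise.} \end{cases}$$ In particular, the map $A\mapsto P(i)^A(T^{(0)})$, where $P(i)^A:=X(i)_2^A\cdots X(i)_n^A\,G(i)^A$, sends $A$ to the tableau given by this formula for $k=2$; and this tableau is the image $\varphi_{i,m}(A)$ of $A$ under the affine crystal isomorphism $\varphi_{i,m}:B^{i,m}\to\mathrm{SSYT}(m\omega_i)$ (that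 is, under any bijection commuting with all $e_\ell,f_\ell$, $0\le\ell\le n$). -/

import Mathlib

namespace KRCrystal

/-! ### The polytope model

A pattern is a function `a : ℕ → ℕ → ℕ`, `a k l` being the entry `a_{k,l}` in column `k ∈ {1,…,i}`
and row `l ∈ {i,…,n}`; entries at all other positions are `0`. -/

/-- Patterns, or arbitrary fillings of the plane by natural numbers. -/
abbrev Grid : Type := ℕ → ℕ → ℕ

/-- Replace the entry at position `p` by `v`. -/
def Grid.set (a : Grid) (p : ℕ × ℕ) (v : ℕ) : Grid :=
  fun k l => if (k, l) = p then v else a k l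

/-- `β(1), …, β(n)` is a Dyck path from `(1,i)` to `(i,n)`. -/
def IsDyckPath (n i : ℕ) (β : ℕ → ℕ × ℕ) : Prop :=
  β 1 = (1, i) ∧ β n = (i, n) ∧
    ∀ r, 1 ≤ r → r < n →
      β (r + 1) = ((β r).1, (β r).2 + 1) ∨ β (r + 1) = ((β r).1 + 1, (β r).2)

/-- The set `B^{i,m}` of the patterns all of whose Dyck path sums are at most `m`. -/
def Polytope (n i m : ℕ) : Type :=
  {a : Grid //
    (∀ k l, ¬ (1 ≤ k ∧ k ≤ i ∧ i ≤ l ∧ l ≤ n) → a k l = 0) ∧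
    ∀ β, IsDyckPath n i β → ∑ r ∈ Finset.Icc 1 n, a (β r).1 (β r).2 ≤ m}

/-- The points of `S` at which `g` is maximal. -/
def argmax (S : Finset ℕ) (g : ℕ → ℕ) : Finset ℕ :=
  S.filter fun p => ∀ q ∈ S, g q ≤ g p

/-- Smallest and largest element of a nonempty finite set. -/
def least (S : Finset ℕ) : ℕ := S.min.untopD 0

def greatest (S : Finset ℕ) : ℕ := S.sup id

/-- Maximal step paths through the rows `l - 1` and `l` (used for `l > i`). -/
def plusSet (i : ℕ) (a : Grid) (l : ℕ) : Finset ℕ :=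
  argmax (Finset.Icc 1 i) fun p =>
    ∑ j ∈ Finset.Icc 1 p, a j (l - 1) + ∑ j ∈ Finset.Icc p i, a j l

/-- Maximal step paths through the columns `l` and `l + 1` (used for `l < i`). -/
def minusSet (n i : ℕ) (a : Grid) (l : ℕ) : Finset ℕ :=
  argmax (Finset.Icc i n) fun p =>
    ∑ j ∈ Finset.Icc i p, a l j + ∑ j ∈ Finset.Icc p n, a (l + 1) j

def pPlus (i : ℕ) (a : Grid) (l : ℕ) : ℕ := least (plusSet i a l)
def qPlus (i : ℕ) (a : Grid) (l : ℕ) : ℕ := greatest (plusSet i a l)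
def pMinus (n i : ℕ) (a : Grid) (l : ℕ) : ℕ := greatest (minusSet n i a l)
def qMinus (n i : ℕ) (a : Grid) (l : ℕ) : ℕ := least (minusSet n i a l)

/-- `φ_l(A)` for `l ∈ {0, 1, …, n}`. -/
def phi (n i m : ℕ) (a : Grid) (l : ℕ) : ℤ :=
  if l = 0 then a 1 n
  else if l = i then
    m - ∑ j ∈ Finset.Icc 1 (i - 1), (a j i : ℤ) - ∑ j ∈ Finset.Icc i n, (a i j : ℤ)
  else if i < l then
    ∑ j ∈ Finset.Icc 1 (pPlus i a l), (a j (l - 1) : ℤ)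
      - ∑ j ∈ Finset.Icc 1 (pPlus i a l - 1), (a j l : ℤ)
  else
    ∑ j ∈ Finset.Icc (pMinus n i a l) n, (a (l + 1) j : ℤ)
      - ∑ j ∈ Finset.Icc (pMinus n i a l + 1) n, (a l j : ℤ)

/-- `ε_l(A)` for `l ∈ {0, 1, …, n}`. -/
def eps (n i m : ℕ) (a : Grid) (l : ℕ) : ℤ :=
  if l = 0 then
    m - ∑ j ∈ Finset.Icc i n, (a 1 j : ℤ) - ∑ j ∈ Finset.Icc 2 i, (a j n : ℤ)
  else if l = i then a i i
  else if i < l then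
    ∑ j ∈ Finset.Icc (qPlus i a l) i, (a j l : ℤ)
      - ∑ j ∈ Finset.Icc (qPlus i a l + 1) i, (a j (l - 1) : ℤ)
  else
    ∑ j ∈ Finset.Icc i (qMinus n i a l), (a l j : ℤ)
      - ∑ j ∈ Finset.Icc i (qMinus n i a l - 1), (a (l + 1) j : ℤ)

/-- Increase the entry at `p` by one and decrease the entry at `q` by one. -/
def Grid.move (a : Grid) (p q : ℕ × ℕ) : Grid :=
  (a.set p (a p.1 p.2 + 1)).set q (a q.1 q.2 - 1)

/-- The lowering operators `f_l`, `l ∈ {0, 1, …, n}`, of the polytope model; `none` is the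
formal zero of the crystal. -/
def fPoly (n i m : ℕ) (l : ℕ) (a : Grid) : Option Grid :=
  if phi n i m a l = 0 then none
  else if l = 0 then some (a.set (1, n) (a 1 n - 1))
  else if l = i then some (a.set (i, i) (a i i + 1))
  else if i < l then some (a.move (pPlus i a l, l) (pPlus i a l, l - 1))
  else some (a.move (l, pMinus n i a l) (l + 1, pMinus n i a l))

/-- The raising operators `e_l`, `l ∈ {0, 1, …, n}`, of the polytope model. -/
def ePoly (n i m : ℕ) (l : ℕ) (a : Grid) : Option Grid :=
  if eps n i m a l = 0 then none
  else if l = 0 then some (a.set (1, n) (a 1 n + 1))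
  else if l = i then some (a.set (i, i) (a i i - 1))
  else if i < l then some (a.move (qPlus i a l, l - 1) (qPlus i a l, l))
  else some (a.move (l + 1, qMinus n i a l) (l, qMinus n i a l))

/-! ### The tableau model

Following Mathlib, the box in row `r + 1` and column `c + 1` of a tableau is `(r, c)`. -/

/-- The rectangular shape `(m^i)`: `i` rows of length `m`. -/
def rect (i m : ℕ) : YoungDiagram where
  cells := Finset.range i ×ˢ Finset.range m
  isLowerSet := by
    rintro ⟨r, c⟩ ⟨r', c'⟩ h hm
    simp only [Finset.coe_product, Finset.coe_range, Set.mem_prod, Set.mem_Iio] at hm ⊢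
    exact ⟨lt_of_le_of_lt h.1 hm.1, lt_of_le_of_lt h.2 hm.2⟩

/-- `SSYT(m ω_i)`: semistandard tableaux of shape `(m^i)` with entries in `{1, …, n + 1}`. -/
def Tableau (n i m : ℕ) : Type :=
  {T : SemistandardYoungTableau (rect i m) //
    ∀ r c, r < i → c < m → 1 ≤ T r c ∧ T r c ≤ n + 1}

/-- The entries of a tableau, as a function of the box (and `0` outside the shape). -/
def Tableau.entries {n i m : ℕ} (T : Tableau n i m) : Grid := T.1.entry

/-- The boxes of `(m^i)` in reading order: rows from bottom to top, each from left to right. -/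
def readingOrder (i m : ℕ) : List (ℕ × ℕ) :=
  (List.range i).reverse.flatMap fun r => (List.range m).map fun c => (r, c)

/-- One step of the pairing of each `j + 1` with the nearest available `j` to its right.
The state consists of the boxes read so far that hold an unpaired `j`, and of those that hold an
unpaired `j + 1`, both with the most recently read box first. -/
def pairStep (j : ℕ) (T : Grid) (st : List (ℕ × ℕ) × List (ℕ × ℕ)) (p : ℕ × ℕ) :
    List (ℕ × ℕ) × List (ℕ × ℕ) :=
  if T p.1 p.2 = j + 1 then (st.1, p :: st.2)
  else if T p.1 p.2 = j then
    match st.2 with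
    | [] => (p :: st.1, [])
    | _ :: vs => (st.1, vs)
  else st

/-- The boxes with an unpaired `j` and with an unpaired `j + 1`, both from right to left in the
reading word. -/
def unpaired (i m j : ℕ) (T : Grid) : List (ℕ × ℕ) × List (ℕ × ℕ) :=
  (readingOrder i m).foldl (pairStep j T) ([], [])

/-- `f_j`, `j ∈ {1, …, n}`: change the rightmost unpaired `j` to `j + 1`. -/
def fSig (i m j : ℕ) (T : Grid) : Option Grid :=
  (unpaired i m j T).1.head?.map fun p => T.set p (j + 1)

/-- `e_j`, `j ∈ {1, …, n}`: change the leftmost unpaired `j + 1` to `j`. -/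
def eSig (i m j : ℕ) (T : Grid) : Option Grid :=
  (unpaired i m j T).2.getLast?.map fun p => T.set p j

/-- Jeu de taquin slide of an empty box `(r, c)` towards the top left corner, in at most the given
number of steps. Boxes that were vacated before hold `0`, and so does the empty box in the end. -/
def slideIn : ℕ → Grid → ℕ → ℕ → Grid
  | 0, T, r, c => T.set (r, c) 0
  | d + 1, T, r, c =>
    let up := if r = 0 then 0 else T (r - 1) c
    let left := if c = 0 then 0 else T r (c - 1)
    if up = 0 ∧ left = 0 then T.set (r, c) 0
    else if left ≤ up then slideIn d (T.set (r, c) up) (r - 1) c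
    else slideIn d (T.set (r, c) left) r (c - 1)

/-- Jeu de taquin slide of an empty box `(r, c)` towards the bottom right corner of `(m^i)`, in at
most the given number of steps. Boxes that were vacated before hold `n + 2`, and so does the empty
box in the end. -/
def slideOut (n i m : ℕ) : ℕ → Grid → ℕ → ℕ → Grid
  | 0, T, r, c => T.set (r, c) (n + 2)
  | d + 1, T, r, c =>
    let down := if r + 1 < i then T (r + 1) c else n + 2
    let right := if c + 1 < m then T r (c + 1) else n + 2
    if down = n + 2 ∧ right = n + 2 then T.set (r, c) (n + 2)
    else if down ≤ right then slideOut n i m d (T.set (r, c) down) (r + 1) c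
    else slideOut n i m d (T.set (r, c) right) r (c + 1)

/-- Schützenberger promotion: remove the entries `n + 1` (they lie in the last row), slide the
empty boxes, from left to right, to the top left corner, fill them with `0`, and increase all
entries by one. -/
def promotion (n i m : ℕ) (T : Grid) : Grid :=
  let S := (List.range m).foldl
    (fun U c => if U (i - 1) c = n + 1 then slideIn (i + m) U (i - 1) c else U) T
  fun r c => if r < i ∧ c < m then S r c + 1 else 0

/-- Inverse promotion: remove the entries `1` (they lie in the first row), slide the empty boxes,
from right to left, to the bottom right corner, fill them with `n + 2`, and decrease all entries
by one. -/
def promotionInv (n i m : ℕ) (T : Grid) : Grid :=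
  let S := (List.range m).reverse.foldl
    (fun U c => if U 0 c = 1 then slideOut n i m (i + m) U 0 c else U) T
  fun r c => if r < i ∧ c < m then S r c - 1 else 0

/-- The lowering operators `f_l`, `l ∈ {0, 1, …, n}`, of the tableau model, with
`f_0 = pr⁻¹ ∘ f_1 ∘ pr`. -/
def fTab (n i m : ℕ) (l : ℕ) (T : Grid) : Option Grid :=
  if l = 0 then (fSig i m 1 (promotion n i m T)).map (promotionInv n i m) else fSig i m l T

/-- The raising operators `e_l`, `l ∈ {0, 1, …, n}`, of the tableau model, with
`e_0 = pr⁻¹ ∘ e_1 ∘ pr`. -/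
def eTab (n i m : ℕ) (l : ℕ) (T : Grid) : Option Grid :=
  if l = 0 then (eSig i m 1 (promotion n i m T)).map (promotionInv n i m) else eSig i m l T

/-- Affine crystal isomorphisms `B^{i,m} → SSYT(m ω_i)`: bijections that respect the arrows of all
colours `l ∈ {0, 1, …, n}`. (Both crystals are seminormal, so such a bijection preserves `ε_l`,
`φ_l` and the weight.) -/
structure IsAffineCrystalIso (n i m : ℕ) (Φ : Polytope n i m → Tableau n i m) : Prop where
  bijective : Function.Bijective Φ
  map_f : ∀ l ≤ n, ∀ A A' : Polytope n i m,
    fPoly n i m l A.1 = some A'.1 ↔ fTab n i m l (Φ A).entries = some (Φ A').entries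
  map_e : ∀ l ≤ n, ∀ A A' : Polytope n i m,
    ePoly n i m l A.1 = some A'.1 ↔ eTab n i m l (Φ A).entries = some (Φ A').entries

/-! ### The path of lowering operators -/

/-- The power `f_j ^ d`, with `f_j(0) = 0`. -/
def fPow (n i m j d : ℕ) : Option Grid → Option Grid :=
  (fun x => x.bind (fTab n i m j))^[d]

/-- The product `F s ∘ F (s + 1) ∘ ⋯ ∘ F t` (the identity if `s > t`). -/
def prodOp (s t : ℕ) (F : ℕ → Option Grid → Option Grid) : Option Grid → Option Grid :=
  (List.range' s (t + 1 - s)).foldr (fun j g => F j ∘ g) id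

/-- `X(i)_ℓ^A`, acting on tableaux. -/
def X (n i m : ℕ) (a : Grid) (l : ℕ) : Option Grid → Option Grid :=
  prodOp (i + 1) l (fun j => fPow n i m (l + i + 1 - j) (∑ p ∈ Finset.Icc 1 i, a p l)) ∘
    prodOp 2 i (fun j => fPow n i m j (∑ p ∈ Finset.Icc 2 j, a p l))

/-- `G(i)^A`, acting on tableaux. -/
def G (n i m : ℕ) (a : Grid) : Option Grid → Option Grid :=
  prodOp 1 i fun p => fPow n i m p (∑ r ∈ Finset.Icc i n, a 1 r)

/-- The highest weight tableau `T^{(0)}`: all entries of the `j`-th row are `j`. -/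
def highestTableau (i m : ℕ) : Grid := fun r c => if r < i ∧ c < m then r + 1 else 0

/-- `T^{(k)} = X(i)_k^A X(i)_{k+1}^A ⋯ X(i)_n^A G(i)^A (T^{(0)})`. -/
def partialTableau (n i m : ℕ) (a : Grid) (k : ℕ) : Option Grid :=
  prodOp k n (X n i m a) (G n i m a (some (highestTableau i m)))

/-- `P(i)^A (T^{(0)})`, where `P(i)^A = X(i)_2^A ⋯ X(i)_n^A G(i)^A`. -/
def pathTableau (n i m : ℕ) (a : Grid) : Option Grid :=
  (prodOp 2 n (X n i m a) ∘ G n i m a) (some (highestTableau i m))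

/-! ### The statistics and the entries -/

/-- `χ` at `k = n - d`, given `Σ_k = σ`. -/
def chiOf (d : ℕ) (σ : ℤ) : ℤ := if d = 0 ∨ σ < 0 then 1 else 0

/-- `Σ_{n-d}`, by recursion on `d`. -/
def SigmaAux (n : ℕ) (a : Grid) : ℕ → ℤ
  | 0 => -(a 2 n : ℤ)
  | d + 1 => (a 1 (n - d) : ℤ) + (1 - chiOf d (SigmaAux n a d)) * SigmaAux n a d
      - (a 2 (n - (d + 1)) : ℤ)

/-- `Σ_k^A`, for `2 ≤ k ≤ n`. -/
def Sigma (n : ℕ) (a : Grid) (k : ℕ) : ℤ := SigmaAux n a (n - k)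

/-- `χ_k^A`, for `2 ≤ k ≤ n`. -/
def chi (n : ℕ) (a : Grid) (k : ℕ) : ℤ := chiOf (n - k) (Sigma n a k)

/-- The multiplicity of `s + t - 1` in the `s`-th row. -/
def mult (m : ℕ) (T : Grid) (s t : ℕ) : ℕ :=
  ((Finset.range m).filter fun c => T (s - 1) c = s + t - 1).card

/-- The asserted multiplicity of `s + t - 1` in the `s`-th row of `T^{(k)}`. -/
def entryFormula (n i m : ℕ) (a : Grid) (k s t : ℕ) : ℤ :=
  if s + 1 = i ∧ t = 1 then m - ∑ j ∈ Finset.Icc i n, (a 1 j : ℤ)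
  else if s + 1 = i ∧ t = 2 then
    ∑ j ∈ Finset.Icc 2 k, (a 1 j : ℤ) + (1 - chi n a k) * Sigma n a k
  else if s = i ∧ t = 1 then
    m - ∑ j ∈ Finset.Icc i n, (a 1 j : ℤ) + ∑ j ∈ Finset.Icc k n, chi n a j * Sigma n a j
  else if s = i ∧ t = 2 ∧ i < k then ∑ j ∈ Finset.Icc i (k - 1), (a 1 j : ℤ)
  else if s + 1 = i ∧ k + 1 ≤ t ∧ t ≤ n then
    (a 2 (t - 1) : ℤ) + chi n a (t - 1) * Sigma n a (t - 1)
  else if s = i ∧ k + 2 ≤ t + i ∧ t + i ≤ n + 2 then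
    (a 1 (t + i - 2) : ℤ) - chi n a (t + i - 2) * Sigma n a (t + i - 2)
  else 0

end KRCrystal

/-! The tableau side and the polytope side of the theorem are both computed step by step along the
path `P(i)^A`, which only uses the operators `f_1, …, f_n`.

*Tableaux.* A tableau with at most two rows is determined by the multiplicities of the letters in
its rows. If the upper row has more letters `j` than the lower row has letters `j + 1`, then `f_j`
changes a letter of the upper row, and otherwise a letter of the lower row (`HasRows.fPow_apply`).
Applying `X(i)_k` to `T^{(k+1)}`, the power of `f_i` finds `a_{2,k} + Σ_k` unmatched letters `i` in
the upper row: if `Σ_k ≥ 0`, it acts on that row only, and otherwise its last `-Σ_k` factors act on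
the lower row (for `i = 1` there is no upper row, and this power is trivial). The powers of
`f_{i+1}, …, f_k` then carry the letters `i + 1` so obtained, together with `a_{1,k}` older letters
`i + 1` of the lower row, to the letter `k + 1` (`IsPattern.hasRows_X`). The lower row never runs
out of letters `i`, because counting the letters `i` in the whole tableau turns their number into
the slack of a Dyck path condition (`IsPattern.sum_deficit_le`).

*Patterns.* In the polytope the same path leads from the zero pattern to `A`
(`Follows.path_apply`): `X(i)_k` brings the entries `a_{1,k}` and `a_{2,k}` from row `i` to row `k`.
So an affine crystal isomorphism `Φ` takes `A` to `P(i)^A` applied to the image of the zero pattern.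
That image is `T^{(0)}`: every pattern, in particular the preimage of `T^{(0)}`, is reached from the
zero pattern along arrows of colours `1, …, n`, while no such arrow ends at `T^{(0)}`
(`fTab_ne_highestTableau`). -/

namespace KRCrystal

/-! ### Products and powers of operators -/

lemma prodOp_of_le {s t : ℕ} (h : s ≤ t) (F : ℕ → Option Grid → Option Grid) :
    prodOp s t F = F s ∘ prodOp (s + 1) t F := by
  unfold prodOp
  obtain ⟨d, rfl⟩ := Nat.exists_eq_add_of_le h
  have h1 : s + d + 1 - s = d + 1 := by omega
  have h2 : s + d + 1 - (s + 1) = d := by omega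
  rw [h1, h2, List.range'_succ, List.foldr_cons]

lemma prodOp_of_lt {s t : ℕ} (h : t < s) (F : ℕ → Option Grid → Option Grid) :
    prodOp s t F = id := by
  unfold prodOp
  have h1 : t + 1 - s = 0 := by omega
  rw [h1]
  rfl

/-- An invariant of the partial products, from the innermost factor outwards. -/
lemma prodOp_induction {P : ℕ → Option Grid → Prop} {F : ℕ → Option Grid → Option Grid}
    {s t : ℕ} (hst : s ≤ t + 1) {x : Option Grid} (h0 : P (t + 1) x)
    (hstep : ∀ j, s ≤ j → j ≤ t → ∀ y, P (j + 1) y → P j (F j y)) :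
    P s (prodOp s t F x) := by
  induction hst using Nat.decreasingInduction with
  | self => rw [prodOp_of_lt (Nat.lt_succ_self t)]; exact h0
  | of_succ k hk ih =>
    rw [prodOp_of_le (by omega), Function.comp_apply]
    exact hstep k le_rfl (by omega) _ (ih fun j hj => hstep j (by omega))

lemma fPow_succ (n i m j d : ℕ) (x : Option Grid) :
    fPow n i m j (d + 1) x = (fPow n i m j d x).bind (fTab n i m j) := by
  unfold fPow
  rw [Function.iterate_succ_apply']

/-! ### The signature rule on tableaux with at most two rows -/

lemma mem_rect {i m r c : ℕ} : (r, c) ∈ rect i m ↔ r < i ∧ c < m := by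
  rw [← YoungDiagram.mem_cells]
  simp [rect]

/-- The multiplicity of `v` in the row with index `r`. -/
def rowCount (m : ℕ) (T : Grid) (r v : ℕ) : ℕ :=
  ((Finset.range m).filter fun c => T r c = v).card

lemma rowCount_succ (N : ℕ) (T : Grid) (r v : ℕ) :
    rowCount (N + 1) T r v = rowCount N T r v + if T r N = v then 1 else 0 := by
  unfold rowCount
  rw [Finset.range_add_one, Finset.filter_insert]
  split_ifs
  · rw [Finset.card_insert_of_notMem (by simp)]
  · rfl

lemma rowCount_eq_zero {N : ℕ} {T : Grid} {r v : ℕ} (h : ∀ c < N, T r c ≠ v) :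
    rowCount N T r v = 0 := by
  unfold rowCount
  rw [Finset.card_eq_zero, Finset.filter_eq_empty_iff]
  intro c hc
  exact h c (Finset.mem_range.1 hc)

/-- Reading a weakly increasing row. The letters `j` of the row first use up the `j + 1` that are
available, and the most recent unpaired `j` is in this row as soon as some `j` is left over. -/
lemma foldl_pairStep_row {j r : ℕ} {T : Grid} {us vs : List (ℕ × ℕ)} (N : ℕ)
    (hT : ∀ c c', c ≤ c' → c' < N → T r c ≤ T r c') :
    let st := ((List.range N).map fun c => (r, c)).foldl (pairStep j T) (us, vs)
    (rowCount N T r j ≤ vs.length → st.1 = us) ∧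
    (vs.length < rowCount N T r j → ∃ c, st.1.head? = some (r, c) ∧ c < N ∧ T r c = j ∧
      ∀ c', c < c' → c' < N → j < T r c') ∧
    st.2.length = (vs.length - rowCount N T r j) + rowCount N T r (j + 1) := by
  induction N with
  | zero => simp [rowCount]
  | succ N ih =>
    obtain ⟨h1, h2, h3⟩ := ih fun c c' h h' => hT c c' h (by omega)
    rw [List.range_succ, List.map_append, List.foldl_append, rowCount_succ, rowCount_succ]
    set st := ((List.range N).map fun c => (r, c)).foldl (pairStep j T) (us, vs) with hst
    simp only [List.map_cons, List.map_nil, List.foldl_cons, List.foldl_nil]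
    unfold pairStep
    by_cases ha : T r N = j + 1
    · have hb : T r N ≠ j := by omega
      simp only [if_pos ha, if_neg hb, add_zero, List.length_cons]
      refine ⟨h1, fun h => ?_, by omega⟩
      obtain ⟨c, hc1, hc2, hc3, hc4⟩ := h2 h
      refine ⟨c, hc1, by omega, hc3, fun c' hc hc' => ?_⟩
      rcases Nat.lt_succ_iff_lt_or_eq.1 hc' with h' | rfl
      · exact hc4 c' hc h'
      · omega
    · by_cases hb : T r N = j
      · have h0 : rowCount N T r (j + 1) = 0 := rowCount_eq_zero fun c hc h => by
          have := hT c N hc.le (Nat.lt_succ_self N)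
          omega
        rw [h0, add_zero] at h3
        simp only [if_pos hb, if_neg ha, h0, add_zero]
        rcases hs : st.2 with _ | ⟨v, ws⟩
        · rw [hs, List.length_nil] at h3
          refine ⟨fun h => by omega, fun _ => ⟨N, rfl, by omega, hb, fun c' hc hc' => by omega⟩, ?_⟩
          simp
          omega
        · rw [hs, List.length_cons] at h3
          refine ⟨fun h => h1 (by omega), fun h => by omega, ?_⟩
          simp only
          omega
      · simp only [ha, if_false, hb, add_zero]
        refine ⟨h1, fun h => ?_, h3⟩
        obtain ⟨c, hc1, hc2, hc3, hc4⟩ := h2 h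
        refine ⟨c, hc1, by omega, hc3, fun c' hc hc' => ?_⟩
        rcases Nat.lt_succ_iff_lt_or_eq.1 hc' with h' | rfl
        · exact hc4 c' hc h'
        · have := hT c c' hc.le (Nat.lt_succ_self _)
          omega

lemma Tableau.row_weak {n i m : ℕ} (T : Tableau n i m) {r c c' : ℕ} (hr : r < i) (h : c ≤ c')
    (hc : c' < m) : T.entries r c ≤ T.entries r c' :=
  T.1.row_weak_of_le h (mem_rect.2 ⟨hr, hc⟩)

lemma Tableau.col_strict {n i m : ℕ} (T : Tableau n i m) {r r' c : ℕ} (h : r < r') (hr : r' < i)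
    (hc : c < m) : T.entries r c < T.entries r' c :=
  T.1.col_strict h (mem_rect.2 ⟨hr, hc⟩)

/-- Multiplicities after `e` letters `j` have become `j + 1`. -/
def moveBy (F : ℕ → ℕ) (j e : ℕ) : ℕ → ℕ := fun v =>
  if v = j then F j - e else if v = j + 1 then F (j + 1) + e else F v

lemma moveBy_zero (F : ℕ → ℕ) (j : ℕ) : moveBy F j 0 = F := by
  funext v
  unfold moveBy
  split_ifs with h1 h2
  · rw [h1, Nat.sub_zero]
  · rw [h2, Nat.add_zero]
  · rfl

lemma moveBy_moveBy (F : ℕ → ℕ) (j d e : ℕ) : moveBy (moveBy F j d) j e = moveBy F j (d + e) := by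
  funext v
  unfold moveBy
  split_ifs <;> omega

lemma rowCount_set {T : Grid} {m r c j : ℕ} (hc : c < m) (h : T r c = j) (v : ℕ) :
    rowCount m (T.set (r, c) (j + 1)) r v = moveBy (rowCount m T r) j 1 v := by
  induction m with
  | zero => omega
  | succ N ih =>
    -- A prefix of the row that ends before the column `c` is not changed.
    have hprefix : ∀ N ≤ c, ∀ v, rowCount N (T.set (r, c) (j + 1)) r v = rowCount N T r v := by
      intro N hN v
      unfold rowCount
      congr 1
      refine Finset.filter_congr fun c' hc' => ?_
      have : c' ≠ c := by have := Finset.mem_range.1 hc'; omega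
      simp [Grid.set, this]
    rcases Nat.lt_succ_iff_lt_or_eq.1 hc with hlt | rfl
    · have hpos : 0 < rowCount N T r j :=
        Finset.card_pos.2 ⟨c, by simp [hlt, h]⟩
      have hN : N ≠ c := by omega
      rw [rowCount_succ, ih hlt]
      simp only [moveBy, rowCount_succ, Grid.set, Prod.mk.injEq, hN, and_false, if_false]
      split_ifs <;> omega
    · rw [rowCount_succ, hprefix c le_rfl]
      simp only [moveBy, rowCount_succ, Grid.set, if_true, h]
      split_ifs <;> first | omega | (subst_vars; omega)

lemma rowCount_set_of_ne {T : Grid} {m r c x r' : ℕ} (h : r' ≠ r) (v : ℕ) :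
    rowCount m (T.set (r, c) x) r' v = rowCount m T r' v := by
  unfold rowCount
  simp [Grid.set, h]

/-- Raising the rightmost `j` of a row keeps the tableau semistandard, if the entry below it is
large enough. -/
def Tableau.raise {n i m : ℕ} (T : Tableau n i m) (r c j : ℕ) (hr : r < i) (hc : c < m)
    (hj : j ≤ n) (h : T.entries r c = j) (hlast : ∀ c', c < c' → c' < m → j < T.entries r c')
    (hbelow : r + 1 < i → j + 1 < T.entries (r + 1) c) : Tableau n i m :=
  ⟨{ entry := T.entries.set (r, c) (j + 1)
     row_weak' := by
       intro s c₁ c₂ hlt hmem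
       obtain ⟨hs, hc2⟩ := mem_rect.1 hmem
       have h0 := T.row_weak hs hlt.le hc2
       simp only [Grid.set, Prod.mk.injEq]
       split_ifs with h1 h2 h2
       · omega
       · obtain ⟨rfl, rfl⟩ := h1
         exact hlast _ hlt hc2
       · obtain ⟨rfl, rfl⟩ := h2
         omega
       · exact h0
     col_strict' := by
       intro s₁ s₂ c' hlt hmem
       obtain ⟨hs, hc2⟩ := mem_rect.1 hmem
       have h0 := T.col_strict hlt hs hc2
       simp only [Grid.set, Prod.mk.injEq]
       split_ifs with h1 h2 h2
       · omega
       · obtain ⟨rfl, rfl⟩ := h1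
         have h3 := hbelow (by omega)
         rcases (Nat.succ_le_of_lt hlt).eq_or_lt with h4 | h4
         · rw [← h4]; exact h3
         · exact h3.trans (T.col_strict h4 hs hc2)
       · obtain ⟨rfl, rfl⟩ := h2
         omega
       · exact h0
     zeros' := by
       intro s c' hmem
       have h1 : ¬ (s = r ∧ c' = c) := by
         rintro ⟨rfl, rfl⟩
         exact hmem (mem_rect.2 ⟨hr, hc⟩)
       simp only [Grid.set, Prod.mk.injEq, h1, if_false]
       exact T.1.zeros hmem },
   by
     intro s c' hs hc'
     have h0 := T.2 s c' hs hc'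
     change 1 ≤ T.entries.set (r, c) (j + 1) s c' ∧ T.entries.set (r, c) (j + 1) s c' ≤ n + 1
     simp only [Grid.set]
     split_ifs
     · omega
     · exact h0⟩

lemma Tableau.raise_entries {n i m : ℕ} (T : Tableau n i m) (r c j : ℕ) (hr : r < i) (hc : c < m)
    (hj : j ≤ n) (h : T.entries r c = j) (hlast : ∀ c', c < c' → c' < m → j < T.entries r c')
    (hbelow : r + 1 < i → j + 1 < T.entries (r + 1) c) :
    (T.raise r c j hr hc hj h hlast hbelow).entries = T.entries.set (r, c) (j + 1) := rfl

/-- `x` is a tableau whose last row has the multiplicities `L` and whose row above the last one,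
if there is one, has the multiplicities `U`. For one-row tableaux `U` is `0`, which is also what
the signature rule makes of a missing row. -/
def HasRows (n i m : ℕ) (U L : ℕ → ℕ) (x : Option Grid) : Prop :=
  ∃ T : Tableau n i m, x = some T.entries ∧ (∀ v, rowCount m T.entries (i - 1) v = L v) ∧
    (i = 2 → ∀ v, rowCount m T.entries 0 v = U v) ∧ (i = 1 → ∀ v, U v = 0)

lemma readingOrder_one (m : ℕ) :
    readingOrder 1 m = (List.range m).map fun c => (0, c) := by
  simp [readingOrder]

lemma readingOrder_two (m : ℕ) :
    readingOrder 2 m =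
      ((List.range m).map fun c => (1, c)) ++ (List.range m).map fun c => (0, c) := by
  simp [readingOrder, List.range_succ]

lemma fTab_eq_of_head {n i m j : ℕ} {T : Grid} {p : ℕ × ℕ} (hj : 1 ≤ j)
    (h : (unpaired i m j T).1.head? = some p) : fTab n i m j T = some (T.set p (j + 1)) := by
  rw [fTab, if_neg (by omega), fSig, h]
  rfl

/-- If the upper row has more letters `j` than the lower row has letters `j + 1`, then `f_j` acts
on the upper row. -/
lemma HasRows.bind_upper {n i m : ℕ} (hi1 : 1 ≤ i) (hi2 : i ≤ 2) {U L : ℕ → ℕ} {x : Option Grid}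
    (hx : HasRows n i m U L x) {j : ℕ} (hj : 1 ≤ j) (hjn : j ≤ n) (h : L (j + 1) < U j) :
    HasRows n i m (moveBy U j 1) L (x.bind (fTab n i m j)) := by
  obtain ⟨T, rfl, hL, hU, hU1⟩ := hx
  obtain rfl : i = 2 := by
    by_contra h'
    have := hU1 (by omega) j
    omega
  have hU := hU rfl
  simp only [show 2 - 1 = 1 from rfl] at hL
  have hlow := foldl_pairStep_row (j := j) (us := []) (vs := []) m
    fun c c' h h' => T.row_weak (r := 1) (by omega) h h'
  set st := ((List.range m).map fun c => (1, c)).foldl (pairStep j T.entries) ([], []) with hst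
  have hup := foldl_pairStep_row (j := j) (us := st.1) (vs := st.2) m
    fun c c' h h' => T.row_weak (r := 0) (by omega) h h'
  simp only [List.length_nil, hL, Nat.zero_sub, Nat.zero_add] at hlow
  simp only [hU, hlow.2.2] at hup
  obtain ⟨c, hc1, hc2, hc3, hc4⟩ := hup.2.1 h
  -- Otherwise the letters `j` of the upper row all stand above letters `j + 1`.
  have hbelow : j + 1 < T.entries 1 c := by
    by_contra hcon
    have hle : rowCount m T.entries 0 j ≤ rowCount m T.entries 1 (j + 1) := by
      refine Finset.card_le_card fun c' hc' => ?_
      simp only [Finset.mem_filter, Finset.mem_range] at hc' ⊢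
      have h1 : c' ≤ c := by
        by_contra h1
        have := hc4 c' (by omega) hc'.1
        omega
      have h2 := T.row_weak (r := 1) (by omega) h1 hc2
      have h3 := T.col_strict (r := 0) (r' := 1) (by omega) (by omega) hc'.1
      exact ⟨hc'.1, by omega⟩
    rw [hL, hU] at hle
    omega
  have hhead : (unpaired 2 m j T.entries).1.head? = some (0, c) := by
    rw [unpaired, readingOrder_two, List.foldl_append]
    exact hc1
  refine ⟨T.raise 0 c j (by omega) hc2 hjn hc3 hc4 fun _ => hbelow, ?_, ?_, ?_, by omega⟩
  · rw [Option.bind_some, fTab_eq_of_head hj hhead, Tableau.raise_entries]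
  · intro v
    rw [Tableau.raise_entries, rowCount_set_of_ne (by omega), ← hL]
  · intro _ v
    rw [Tableau.raise_entries, rowCount_set hc2 hc3, funext hU]

/-- If the upper row has at most as many letters `j` as the lower row has letters `j + 1`, then
`f_j` acts on the lower row. -/
lemma HasRows.bind_lower {n i m : ℕ} (hi1 : 1 ≤ i) (hi2 : i ≤ 2) {U L : ℕ → ℕ} {x : Option Grid}
    (hx : HasRows n i m U L x) {j : ℕ} (hj : 1 ≤ j) (hjn : j ≤ n) (h : U j ≤ L (j + 1))
    (hpos : 0 < L j) :
    HasRows n i m U (moveBy L j 1) (x.bind (fTab n i m j)) := by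
  obtain ⟨T, rfl, hL, hU, hU1⟩ := hx
  have hlow := foldl_pairStep_row (j := j) (us := []) (vs := []) m
    fun c c' h h' => T.row_weak (r := i - 1) (by omega) h h'
  set st := ((List.range m).map fun c => (i - 1, c)).foldl (pairStep j T.entries) ([], []) with hst
  simp only [List.length_nil, hL, Nat.zero_sub, Nat.zero_add] at hlow
  obtain ⟨c, hc1, hc2, hc3, hc4⟩ := hlow.2.1 hpos
  have hhead : (unpaired i m j T.entries).1.head? = some (i - 1, c) := by
    rcases (by omega : i = 1 ∨ i = 2) with rfl | rfl
    · rw [unpaired, readingOrder_one]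
      exact hc1
    · have hup := foldl_pairStep_row (j := j) (us := st.1) (vs := st.2) m
        fun c c' h h' => T.row_weak (r := 0) (by omega) h h'
      simp only [hU rfl, hlow.2.2] at hup
      rw [unpaired, readingOrder_two, List.foldl_append, ← hc1]
      exact congrArg List.head? (hup.1 h)
  refine ⟨T.raise (i - 1) c j (by omega) hc2 hjn hc3 hc4 fun _ => by omega, ?_, ?_, ?_, hU1⟩
  · rw [Option.bind_some, fTab_eq_of_head hj hhead, Tableau.raise_entries]
  · intro v
    rw [Tableau.raise_entries, rowCount_set hc2 hc3, funext hL]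
  · intro hi v
    rw [Tableau.raise_entries, rowCount_set_of_ne (by omega), hU hi]

/-- A power of `f_j` acts on the upper row first, until its letters `j` are matched by the letters
`j + 1` of the lower row, and then on the lower row. -/
lemma HasRows.fPow_apply {n i m : ℕ} (hi1 : 1 ≤ i) (hi2 : i ≤ 2) {U L : ℕ → ℕ} {x : Option Grid}
    (hx : HasRows n i m U L x) {j : ℕ} (hj : 1 ≤ j) (hjn : j ≤ n) {d e : ℕ}
    (hd : d ≤ U j - L (j + 1)) (he : e ≤ L j) (hde : e = 0 ∨ d = U j - L (j + 1)) :
    HasRows n i m (moveBy U j d) (moveBy L j e) (fPow n i m j (d + e) x) := by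
  have hupper : ∀ d ≤ U j - L (j + 1), HasRows n i m (moveBy U j d) L (fPow n i m j d x) := by
    intro d hd
    induction d with
    | zero => rw [moveBy_zero]; exact hx
    | succ d ih =>
      rw [fPow_succ, ← moveBy_moveBy]
      refine (ih (by omega)).bind_upper hi1 hi2 hj hjn ?_
      simp only [moveBy, if_true]
      omega
  induction e with
  | zero => rw [moveBy_zero]; exact hupper d hd
  | succ e ih =>
    rw [← Nat.add_assoc, fPow_succ, ← moveBy_moveBy]
    refine (ih (by omega) (by omega)).bind_lower hi1 hi2 hj hjn ?_ ?_
    · simp only [moveBy, if_true]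
      rw [if_neg (by omega)]
      omega
    · simp only [moveBy, if_true]
      omega

/-! ### Patterns with at most two columns -/

/-- The Dyck path conditions for `i ≤ 2`, written out: a path is determined by the row `r` in which
it changes from the first to the second column. For `i = 1` the second column is zero, and the
conditions follow from the one with `r = n`. -/
structure IsPattern (n i m : ℕ) (a : Grid) : Prop where
  zero : ∀ k l, ¬ (1 ≤ k ∧ k ≤ i ∧ i ≤ l ∧ l ≤ n) → a k l = 0
  path : ∀ r, i ≤ r → r ≤ n →
    ∑ j ∈ Finset.Icc i r, a 1 j + ∑ j ∈ Finset.Icc r n, a 2 j ≤ m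

lemma sum_Icc_eq_add {k n : ℕ} (h : k ≤ n) (f : ℕ → ℕ) :
    ∑ j ∈ Finset.Icc k n, f j = f k + ∑ j ∈ Finset.Icc (k + 1) n, f j := by
  rw [← Finset.add_sum_Ioc_eq_sum_Icc h, Finset.Icc_add_one_left_eq_Ioc]

lemma sum_Icc_pred_add {i k : ℕ} (h1 : 1 ≤ k) (h : i ≤ k) (f : ℕ → ℕ) :
    ∑ j ∈ Finset.Icc i k, f j = ∑ j ∈ Finset.Icc i (k - 1), f j + f k := by
  obtain ⟨d, rfl⟩ := Nat.exists_eq_add_of_le' h1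
  rw [Finset.sum_Icc_succ_top h, Nat.add_sub_cancel]

/-- `∑_{r=i}^n a_{1,r}`, the exponent in `G(i)^A`. -/
def total (n i : ℕ) (a : Grid) : ℕ := ∑ r ∈ Finset.Icc i n, a 1 r

lemma IsPattern.total_le {n i m : ℕ} {a : Grid} (ha : IsPattern n i m a) (h : i ≤ n) :
    total n i a ≤ m :=
  (Nat.le_add_right _ _).trans (ha.path n h le_rfl)

lemma IsPattern.sum_column {n i m : ℕ} {a : Grid} (ha : IsPattern n i m a) (hi1 : 1 ≤ i)
    (hi2 : i ≤ 2) (k : ℕ) : ∑ p ∈ Finset.Icc 1 i, a p k = a 1 k + a 2 k := by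
  rcases (by omega : i = 1 ∨ i = 2) with rfl | rfl
  · simp [ha.zero 2 k (by omega)]
  · rw [sum_Icc_eq_add (by omega)]
    simp

/-! ### The operators `X(i)_k` -/

/-- The factor on the right in `X(i)_k` is a power of `f_i`. -/
lemma IsPattern.prodOp_right {n i m : ℕ} {a : Grid} (ha : IsPattern n i m a) (hi1 : 1 ≤ i)
    (hi2 : i ≤ 2) (k : ℕ) :
    prodOp 2 i (fun j => fPow n i m j (∑ p ∈ Finset.Icc 2 j, a p k)) =
      fPow n i m i (a 2 k) := by
  rcases (by omega : i = 1 ∨ i = 2) with rfl | rfl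
  · rw [prodOp_of_lt (by omega), ha.zero 2 k (by omega)]
    rfl
  · rw [prodOp_of_le le_rfl, prodOp_of_lt (by omega)]
    simp

/-- A property that is carried along `f_i^{a_{2,k}}` and then along the powers of
`f_{i+1}, …, f_k` is carried along `X(i)_k`. -/
lemma IsPattern.X_induction {n i m : ℕ} {a : Grid} (ha : IsPattern n i m a) (hi1 : 1 ≤ i)
    (hi2 : i ≤ 2) {k : ℕ} (hk : 2 ≤ k) {P : ℕ → Option Grid → Prop} {x : Option Grid}
    (h0 : P i (fPow n i m i (a 2 k) x))
    (hstep : ∀ l, i ≤ l → l < k → ∀ y, P l y → P (l + 1) (fPow n i m (l + 1) (a 1 k + a 2 k) y)) :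
    P k (X n i m a k x) := by
  unfold X
  rw [Function.comp_apply, ha.prodOp_right hi1 hi2 k, ha.sum_column hi1 hi2 k]
  have h := prodOp_induction (P := fun j => P (k + i + 1 - j)) (s := i + 1) (t := k)
    (F := fun j => fPow n i m (k + i + 1 - j) (a 1 k + a 2 k)) (by omega)
    (x := fPow n i m i (a 2 k) x) ?_ ?_
  · simpa [show k + i + 1 - (i + 1) = k by omega] using h
  · simpa [show k + i + 1 - (k + 1) = i by omega] using h0
  · intro j hj1 hj2 y hy
    have h1 := hstep (k + i + 1 - (j + 1)) (by omega) (by omega) y hy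
    rwa [show k + i + 1 - (j + 1) + 1 = k + i + 1 - j by omega] at h1

/-! ### The positive and negative parts of `Σ_k` -/

/-- `(1 - χ_k) Σ_k`, the positive part of `Σ_k`, extended by `0` to `k > n`. -/
def excess (n : ℕ) (a : Grid) (k : ℕ) : ℕ := if k ≤ n then (Sigma n a k).toNat else 0

/-- `-χ_k Σ_k`, the negative part of `Σ_k`, extended by `0` to `k > n`. -/
def deficit (n : ℕ) (a : Grid) (k : ℕ) : ℕ := if k ≤ n then (-Sigma n a k).toNat else 0

lemma deficit_of_lt {n k : ℕ} (a : Grid) (h : n < k) : deficit n a k = 0 := by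
  rw [deficit, if_neg (by omega)]

lemma excess_of_lt {n k : ℕ} (a : Grid) (h : n < k) : excess n a k = 0 := by
  rw [excess, if_neg (by omega)]

lemma Sigma_self (n : ℕ) (a : Grid) : Sigma n a n = -(a 2 n : ℤ) := by
  rw [Sigma, Nat.sub_self, SigmaAux]

lemma one_sub_chi_mul_Sigma {n k : ℕ} (a : Grid) (h : k ≤ n) :
    (1 - chi n a k) * Sigma n a k = excess n a k := by
  unfold chi chiOf excess
  rw [if_pos h]
  split_ifs with h1
  · have h2 : Sigma n a k ≤ 0 := by
      rcases h1 with h1 | h1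
      · obtain rfl : k = n := by omega
        rw [Sigma_self]
        omega
      · omega
    rw [Int.toNat_of_nonpos h2]
    simp
  · have h2 : 0 ≤ Sigma n a k := by omega
    rw [Int.toNat_of_nonneg h2]
    simp

lemma chi_mul_Sigma {n k : ℕ} (a : Grid) (h : k ≤ n) :
    chi n a k * Sigma n a k = -(deficit n a k : ℤ) := by
  have h1 := one_sub_chi_mul_Sigma a h
  have h2 : ((excess n a k : ℕ) : ℤ) - deficit n a k = Sigma n a k := by
    unfold excess deficit
    rw [if_pos h, if_pos h]
    exact Int.toNat_sub_toNat_neg _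
  linarith

lemma deficit_or_excess (n : ℕ) (a : Grid) (k : ℕ) : deficit n a k = 0 ∨ excess n a k = 0 := by
  unfold excess deficit
  split_ifs <;> omega

/-- The recursion for `Σ_k`, without signs. -/
lemma excess_recursion {n k : ℕ} {a : Grid} (ha : a 1 (n + 1) = 0) (h : k ≤ n) :
    a 1 (k + 1) + excess n a (k + 1) + deficit n a k = a 2 k + excess n a k := by
  rcases h.eq_or_lt with rfl | hlt
  · rw [ha, excess_of_lt a (Nat.lt_succ_self k), excess, deficit, if_pos le_rfl, if_pos le_rfl,
      Sigma_self]
    omega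
  · have h1 := one_sub_chi_mul_Sigma a (Nat.succ_le_of_lt hlt)
    have h2 : Sigma n a k =
        a 1 (k + 1) + (1 - chi n a (k + 1)) * Sigma n a (k + 1) - a 2 k := by
      obtain ⟨d, rfl⟩ := Nat.exists_eq_add_of_lt hlt
      unfold chi Sigma
      rw [show k + d + 1 - k = d + 1 by omega, show k + d + 1 - (k + 1) = d by omega, SigmaAux,
        show k + d + 1 - d = k + 1 by omega, show k + d + 1 - (d + 1) = k by omega]
    have h3 := one_sub_chi_mul_Sigma a h
    have h4 := chi_mul_Sigma a h
    have h5 : ((a 1 (k + 1) + excess n a (k + 1) + deficit n a k : ℕ) : ℤ) =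
        ((a 2 k + excess n a k : ℕ) : ℤ) := by
      push_cast
      rw [show k.succ = k + 1 from rfl] at h1
      linarith
    exact_mod_cast h5

lemma IsPattern.deficit_le {n i m : ℕ} {a : Grid} (ha : IsPattern n i m a) {k : ℕ} (h : k ≤ n) :
    deficit n a k ≤ a 2 k := by
  have h1 := excess_recursion (ha.zero 1 (n + 1) (by omega)) h
  have h2 := deficit_or_excess n a k
  omega

/-- Two ways to count the letters `2` that the operators `X(2)_n, …, X(2)_k` have raised. -/
lemma IsPattern.sum_deficit {n i m : ℕ} {a : Grid} (ha : IsPattern n i m a) {k : ℕ} (hik : i ≤ k)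
    (h : k ≤ n + 1) :
    ∑ j ∈ Finset.Icc i k, a 1 j + excess n a k + ∑ j ∈ Finset.Icc k n, a 2 j =
      total n i a + ∑ j ∈ Finset.Icc k n, deficit n a j := by
  induction h using Nat.decreasingInduction with
  | self =>
    rw [Finset.Icc_eq_empty (by omega : ¬ n + 1 ≤ n), excess_of_lt a (Nat.lt_succ_self n),
      Finset.sum_Icc_succ_top hik, ha.zero 1 (n + 1) (by omega)]
    simp [total]
  | of_succ k hk ih =>
    have h1 := ih (by omega)
    have h2 := excess_recursion (ha.zero 1 (n + 1) (by omega)) (show k ≤ n by omega)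
    rw [Finset.sum_Icc_succ_top (by omega)] at h1
    rw [sum_Icc_eq_add (show k ≤ n by omega), sum_Icc_eq_add (show k ≤ n by omega) (deficit n a)]
    omega

/-- The letters `i` of the last row suffice for all powers of `f_i`: this is where the Dyck path
conditions enter. -/
lemma IsPattern.sum_deficit_le {n i m : ℕ} {a : Grid} (ha : IsPattern n i m a) (hin : i ≤ n)
    {k : ℕ} (hik : i ≤ k) (h : k ≤ n + 1) :
    total n i a + ∑ j ∈ Finset.Icc k n, deficit n a j ≤ m := by
  induction h using Nat.decreasingInduction with
  | self => simpa using ha.total_le hin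
  | of_succ k hk ih =>
    have hkn : k ≤ n := by omega
    rcases deficit_or_excess n a k with h1 | h1
    · rw [sum_Icc_eq_add hkn, h1, Nat.zero_add]
      exact ih (by omega)
    · rw [← ha.sum_deficit hik (by omega), h1]
      exact ha.path k hik hkn

/-! ### The rows of the tableaux `T^{(k)}` -/

/-- The multiplicities in the upper row while `X(i)_k` is being applied: the letters that
`X(i)_k` raises have reached `l + 1`. For `l = k` this is the upper row of `T^{(k)}`. -/
def upperRow (n i m : ℕ) (a : Grid) (k l v : ℕ) : ℕ :=
  if i = 2 then
    if v = 1 then m - total n i a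
    else if v = 2 then ∑ j ∈ Finset.Icc i k, a 1 j + excess n a k
    else (if v = l + 1 then a 2 k - deficit n a k else 0)
      + if k + 2 ≤ v then a 2 (v - 1) - deficit n a (v - 1) else 0
  else 0

/-- The multiplicities in the last row while `X(i)_k` is being applied, as in `upperRow`. -/
def lowerRow (n i m : ℕ) (a : Grid) (k l v : ℕ) : ℕ :=
  if v = i then m - total n i a - ∑ j ∈ Finset.Icc k n, deficit n a j
  else (if v = i + 1 then ∑ j ∈ Finset.Icc i (k - 1), a 1 j else 0)
    + (if v = l + 1 then a 1 k + deficit n a k else 0)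
    + if k + 2 ≤ v then a 1 (v - 1) + deficit n a (v - 1) else 0

lemma IsPattern.moveBy_upperRow_first {n i m : ℕ} {a : Grid} (ha : IsPattern n i m a)
    (hi1 : 1 ≤ i) (hi2 : i ≤ 2) {k : ℕ} (hk : 2 ≤ k) (hkn : k ≤ n) :
    moveBy (upperRow n i m a (k + 1) (k + 1)) i (a 2 k - deficit n a k) =
      upperRow n i m a k i := by
  have hd := ha.deficit_le hkn
  have hrec := excess_recursion (ha.zero 1 (n + 1) (by omega)) hkn
  have hs := Finset.sum_Icc_succ_top (show i ≤ k + 1 by omega) (a 1)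
  rcases (by omega : i = 1 ∨ i = 2) with rfl | rfl
  · rw [ha.zero 2 k (by omega), Nat.zero_sub, moveBy_zero]
    rfl
  · funext v
    rcases eq_or_ne v (k + 2) with rfl | hv
    · simp [moveBy, upperRow, show k ≠ 0 by omega, show k ≠ 1 by omega]
    · simp only [moveBy, upperRow, if_true]
      split_ifs <;> omega

lemma moveBy_lowerRow_first {n i m : ℕ} {a : Grid} (hi1 : 1 ≤ i) (hi2 : i ≤ 2) {k : ℕ}
    (hk : 2 ≤ k) (hkn : k ≤ n) :
    moveBy (lowerRow n i m a (k + 1) (k + 1)) i (deficit n a k) = lowerRow n i m a k i := by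
  have hs := sum_Icc_pred_add (show 1 ≤ k by omega) (show i ≤ k by omega) (a 1)
  have hs' := sum_Icc_eq_add hkn (deficit n a)
  funext v
  rcases eq_or_ne v (k + 2) with rfl | hv
  · simp only [moveBy, lowerRow, Nat.add_sub_cancel]
    split_ifs <;> first | omega | simp
  · simp only [moveBy, lowerRow, Nat.add_sub_cancel]
    split_ifs <;> omega

lemma IsPattern.moveBy_upperRow {n i m : ℕ} {a : Grid} (ha : IsPattern n i m a)
    (hi1 : 1 ≤ i) (hi2 : i ≤ 2) {k l : ℕ} (hl : i ≤ l) (hlk : l < k) :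
    moveBy (upperRow n i m a k l) (l + 1) (a 2 k - deficit n a k) =
      upperRow n i m a k (l + 1) := by
  rcases (by omega : i = 1 ∨ i = 2) with rfl | rfl
  · rw [ha.zero 2 k (by omega), Nat.zero_sub, moveBy_zero]
    rfl
  · funext v
    simp only [moveBy, upperRow, if_true]
    split_ifs <;> omega

lemma moveBy_lowerRow {n i m : ℕ} {a : Grid} {k l : ℕ} (hl : i ≤ l) (hlk : l < k) :
    moveBy (lowerRow n i m a k l) (l + 1) (a 1 k + deficit n a k) =
      lowerRow n i m a k (l + 1) := by
  funext v
  simp only [moveBy, lowerRow]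
  split_ifs <;> omega

/-- One operator `X(i)_k` takes `T^{(k+1)}` to `T^{(k)}`. -/
lemma IsPattern.hasRows_X {n i m : ℕ} {a : Grid} (ha : IsPattern n i m a)
    (hi1 : 1 ≤ i) (hi2 : i ≤ 2) {k : ℕ} (hk : 2 ≤ k) (hkn : k ≤ n) {x : Option Grid}
    (hx : HasRows n i m (upperRow n i m a (k + 1) (k + 1)) (lowerRow n i m a (k + 1) (k + 1)) x) :
    HasRows n i m (upperRow n i m a k k) (lowerRow n i m a k k) (X n i m a k x) := by
  have hd := ha.deficit_le hkn
  have hrec := excess_recursion (ha.zero 1 (n + 1) (by omega)) hkn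
  have hde := deficit_or_excess n a k
  refine ha.X_induction hi1 hi2 hk
    (P := fun l => HasRows n i m (upperRow n i m a k l) (lowerRow n i m a k l)) ?_ ?_
  · rw [← ha.moveBy_upperRow_first hi1 hi2 hk hkn,
      ← moveBy_lowerRow_first hi1 hi2 hk hkn]
    have hL : deficit n a k ≤ lowerRow n i m a (k + 1) (k + 1) i := by
      have h1 := ha.sum_deficit_le (by omega) (show i ≤ k by omega) (by omega)
      rw [sum_Icc_eq_add hkn] at h1
      rw [lowerRow, if_pos rfl]
      omega
    have hdiff : deficit n a k = 0 ∧ a 2 k = 0 ∨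
        upperRow n i m a (k + 1) (k + 1) i - lowerRow n i m a (k + 1) (k + 1) (i + 1) =
          a 1 (k + 1) + excess n a (k + 1) := by
      rcases (by omega : i = 1 ∨ i = 2) with rfl | rfl
      · have := ha.zero 2 k (by omega)
        omega
      · right
        have hs := Finset.sum_Icc_succ_top (show 2 ≤ k + 1 by omega) (a 1)
        simp [upperRow, lowerRow, show k ≠ 1 by omega, show ¬ k + 1 + 2 ≤ 3 by omega, hs]
        omega
    have h := hx.fPow_apply hi1 hi2 (j := i) hi1 (by omega) (d := a 2 k - deficit n a k)
      (e := deficit n a k) (by omega) hL (by omega)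
    rwa [Nat.sub_add_cancel hd] at h
  · intro l hl hlk y hy
    rw [← ha.moveBy_upperRow hi1 hi2 hl hlk, ← moveBy_lowerRow hl hlk]
    have hdiff : upperRow n i m a k l (l + 1) - lowerRow n i m a k l (l + 1 + 1) =
        a 2 k - deficit n a k := by
      have h1 : lowerRow n i m a k l (l + 1 + 1) = 0 := by
        rw [lowerRow, if_neg (by omega), if_neg (by omega), if_neg (by omega), if_neg (by omega)]
      rw [h1]
      rcases (by omega : i = 1 ∨ i = 2) with rfl | rfl
      · rw [ha.zero 2 k (by omega)]
        simp [upperRow]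
      · simp [upperRow, show l ≠ 0 by omega, show l ≠ 1 by omega, show ¬ k + 2 ≤ l + 1 by omega]
    have hL : a 1 k + deficit n a k ≤ lowerRow n i m a k l (l + 1) := by
      rw [lowerRow, if_neg (by omega), if_pos rfl]
      omega
    have h := hy.fPow_apply hi1 hi2 (j := l + 1) (by omega) (by omega)
      (d := a 2 k - deficit n a k) (e := a 1 k + deficit n a k) (by omega) hL (by omega)
    rwa [show a 2 k - deficit n a k + (a 1 k + deficit n a k) = a 1 k + a 2 k by omega] at h

/-! ### The highest weight tableau -/

/-- `T^{(0)}` as a tableau. -/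
def highest (n i m : ℕ) (hin : i ≤ n) : Tableau n i m :=
  ⟨{ entry := highestTableau i m
     row_weak' := by
       intro r c c' h hmem
       have := mem_rect.1 hmem
       rw [highestTableau, highestTableau, if_pos (by omega), if_pos (by omega)]
     col_strict' := by
       intro r r' c h hmem
       have := mem_rect.1 hmem
       rw [highestTableau, highestTableau, if_pos (by omega), if_pos (by omega)]
       omega
     zeros' := by
       intro r c hmem
       rw [mem_rect] at hmem
       rw [highestTableau, if_neg hmem] },
   by
     intro r c hr hc
     change 1 ≤ highestTableau i m r c ∧ highestTableau i m r c ≤ n + 1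
     rw [highestTableau, if_pos ⟨hr, hc⟩]
     omega⟩

lemma highest_entries {n i m : ℕ} (hin : i ≤ n) :
    (highest n i m hin).entries = highestTableau i m := rfl

lemma rowCount_highestTableau {i m r : ℕ} (hr : r < i) (v : ℕ) :
    rowCount m (highestTableau i m) r v = if v = r + 1 then m else 0 := by
  unfold rowCount
  split_ifs with h
  · rw [Finset.filter_true_of_mem, Finset.card_range]
    intro c hc
    rw [highestTableau, if_pos ⟨hr, Finset.mem_range.1 hc⟩, h]
  · rw [Finset.card_eq_zero, Finset.filter_eq_empty_iff]
    intro c hc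
    rw [highestTableau, if_pos ⟨hr, Finset.mem_range.1 hc⟩]
    omega

lemma hasRows_highest {n i m : ℕ} (hi1 : 1 ≤ i) (hin : i ≤ n) :
    HasRows n i m (fun v => if i = 2 ∧ v = 1 then m else 0) (fun v => if v = i then m else 0)
      (some (highestTableau i m)) := by
  refine ⟨highest n i m hin, rfl, fun v => ?_, fun h v => ?_, fun h v => ?_⟩
  · rw [highest_entries, rowCount_highestTableau (by omega), Nat.sub_add_cancel hi1]
  · rw [highest_entries, rowCount_highestTableau (by omega)]
    simp [h]
  · simp [h]

lemma G_one (n m : ℕ) (a : Grid) (x : Option Grid) :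
    G n 1 m a x = fPow n 1 m 1 (total n 1 a) x := by
  rw [G, prodOp_of_le le_rfl, prodOp_of_lt (by omega)]
  rfl

lemma G_two (n m : ℕ) (a : Grid) (x : Option Grid) :
    G n 2 m a x = fPow n 2 m 1 (total n 2 a) (fPow n 2 m 2 (total n 2 a) x) := by
  rw [G, prodOp_of_le (by omega), prodOp_of_le le_rfl, prodOp_of_lt (by omega)]
  rfl

lemma IsPattern.hasRows_G {n i m : ℕ} {a : Grid} (ha : IsPattern n i m a)
    (hi1 : 1 ≤ i) (hi2 : i ≤ 2) (hn : 2 ≤ n) :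
    HasRows n i m (upperRow n i m a (n + 1) (n + 1)) (lowerRow n i m a (n + 1) (n + 1))
      (G n i m a (some (highestTableau i m))) := by
  have hx := hasRows_highest (n := n) (m := m) hi1 (by omega : i ≤ n)
  have hm := ha.total_le (by omega)
  have h1 : ∀ v, n < v → a 1 v = 0 := fun v hv => ha.zero _ _ (by omega)
  have h2 : ∀ v, n < v → a 2 v = 0 := fun v hv => ha.zero _ _ (by omega)
  have hd : ∀ v, n < v → deficit n a v = 0 := fun v hv => deficit_of_lt a hv
  have hs : ∑ j ∈ Finset.Icc i (n + 1), a 1 j = total n i a := by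
    rw [Finset.sum_Icc_succ_top (by omega), h1 _ (Nat.lt_succ_self n)]
    rfl
  have hs' : ∑ j ∈ Finset.Icc i (n + 1 - 1), a 1 j = total n i a := rfl
  have he : ∑ j ∈ Finset.Icc (n + 1) n, deficit n a j = 0 := by simp
  have hL : lowerRow n i m a (n + 1) (n + 1) =
      moveBy (fun v => if v = i then m else 0) i (total n i a) := by
    funext v
    simp only [lowerRow, moveBy, hs', he, if_true, h1 _ (Nat.lt_succ_self n),
      hd _ (Nat.lt_succ_self n)]
    by_cases hv : n + 1 + 2 ≤ v
    · rw [h1 (v - 1) (by omega), hd (v - 1) (by omega)]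
      split_ifs <;> omega
    · split_ifs <;> omega
  have hU : upperRow n i m a (n + 1) (n + 1) =
      moveBy (fun v => if i = 2 ∧ v = 1 then m else 0) 1 (if i = 2 then total n i a else 0) := by
    funext v
    simp only [upperRow, moveBy, hs, excess_of_lt a (Nat.lt_succ_self n),
      h2 _ (Nat.lt_succ_self n), and_true]
    by_cases hv : n + 1 + 2 ≤ v
    · rw [h2 (v - 1) (by omega)]
      split_ifs <;> omega
    · split_ifs <;> omega
  rw [hU, hL]
  rcases (by omega : i = 1 ∨ i = 2) with rfl | rfl
  · rw [G_one]
    have h := hx.fPow_apply hi1 hi2 (j := 1) le_rfl (by omega) (d := 0) (e := total n 1 a)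
      (by simp) (by simpa using hm) (by simp)
    simpa [moveBy_zero] using h
  · rw [G_two]
    have h := hx.fPow_apply hi1 hi2 (j := 2) (by omega) (by omega) (d := 0) (e := total n 2 a)
      (by simp) (by simpa using hm) (by simp)
    rw [moveBy_zero, Nat.zero_add] at h
    have h' := h.fPow_apply hi1 hi2 (j := 1) le_rfl (by omega) (d := total n 2 a) (e := 0)
      (by simp [moveBy]; omega) (by omega) (by omega)
    rw [moveBy_zero] at h'
    simpa using h'

/-- The rows of `T^{(k)}`. -/
lemma IsPattern.hasRows_partialTableau {n i m : ℕ} {a : Grid} (ha : IsPattern n i m a)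
    (hi1 : 1 ≤ i) (hi2 : i ≤ 2) {k : ℕ} (hk : 2 ≤ k) (hkn : k ≤ n) :
    HasRows n i m (upperRow n i m a k k) (lowerRow n i m a k k) (partialTableau n i m a k) :=
  prodOp_induction
    (P := fun k => HasRows n i m (upperRow n i m a k k) (lowerRow n i m a k k)) (by omega)
    (ha.hasRows_G hi1 hi2 (by omega))
    fun _ hj hj' _ hy => ha.hasRows_X hi1 hi2 (by omega) hj' hy

/-- The asserted multiplicities are the ones found in the rows of `T^{(k)}`. -/
lemma IsPattern.exists_partialTableau {n i m : ℕ} {a : Grid} (ha : IsPattern n i m a)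
    (hi1 : 1 ≤ i) (hi2 : i ≤ 2) {k : ℕ} (hk : 2 ≤ k) (hkn : k ≤ n) :
    ∃ T : Tableau n i m, partialTableau n i m a k = some T.entries ∧
      ∀ s ∈ Finset.Icc 1 i, ∀ t ∈ Finset.Icc 1 (n + 2 - i),
        (mult m T.entries s t : ℤ) = entryFormula n i m a k s t := by
  obtain ⟨T, hT, hL, hU, -⟩ := ha.hasRows_partialTableau hi1 hi2 hk hkn
  refine ⟨T, hT, fun s hs t ht => ?_⟩
  rw [Finset.mem_Icc] at hs ht
  have hmult : mult m T.entries s t = rowCount m T.entries (s - 1) (s + t - 1) := rfl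
  have htot : ((total n i a : ℕ) : ℤ) = ∑ j ∈ Finset.Icc i n, (a 1 j : ℤ) := by
    simp [total]
  have hm := ha.total_le (by omega)
  have hchi : ∑ j ∈ Finset.Icc k n, chi n a j * Sigma n a j =
      -((∑ j ∈ Finset.Icc k n, deficit n a j : ℕ) : ℤ) := by
    rw [Nat.cast_sum, ← Finset.sum_neg_distrib]
    exact Finset.sum_congr rfl fun j hj => chi_mul_Sigma a (Finset.mem_Icc.1 hj).2
  have hdef := ha.sum_deficit_le (by omega) (show i ≤ k by omega) (by omega)
  rcases (by omega : s = i ∨ (s = 1 ∧ i = 2)) with rfl | ⟨rfl, rfl⟩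
  · rw [hmult, hL]
    unfold entryFormula
    rw [if_neg (by omega), if_neg (by omega)]
    rcases (by omega : t = 1 ∨ t = 2 ∧ s < k ∨ (k + 2 ≤ t + s ∧ ¬ t = 1 ∧ ¬ (t = 2 ∧ s < k)) ∨
      ((¬ k + 2 ≤ t + s) ∧ ¬ t = 1 ∧ ¬ (t = 2 ∧ s < k))) with
      rfl | ⟨rfl, h⟩ | ⟨h, h1, h2⟩ | ⟨h, h1, h2⟩
    · rw [if_pos ⟨rfl, rfl⟩, lowerRow, if_pos (by omega), hchi, ← htot]
      omega
    · rw [if_neg (by omega), if_pos ⟨rfl, rfl, h⟩, lowerRow, if_neg (by omega),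
        if_pos (by omega), if_neg (by omega), if_neg (by omega)]
      simp
    · rw [if_neg (by omega), if_neg (by omega), if_neg (by omega), if_pos (by omega),
        chi_mul_Sigma a (by omega), lowerRow, if_neg (by omega)]
      have hsum : (if s + t - 1 = s + 1 then ∑ j ∈ Finset.Icc s (k - 1), a 1 j else 0) = 0 := by
        split_ifs with h3
        · rw [Finset.Icc_eq_empty (by omega), Finset.sum_empty]
        · rfl
      rw [hsum, show t + s - 2 = s + t - 1 - 1 by omega]
      rcases (by omega : s + t - 1 = k + 1 ∨ k + 2 ≤ s + t - 1) with h3 | h3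
      · rw [if_pos h3, if_neg (by omega), h3]
        simp
      · rw [if_neg (by omega), if_pos h3]
        simp
    · rw [if_neg (by omega), if_neg (by omega), if_neg (by omega), if_neg (by omega), lowerRow,
        if_neg (by omega), if_neg (by omega), if_neg (by omega), if_neg (by omega)]
      rfl
  · rw [hmult, hU rfl]
    unfold entryFormula
    rcases (by omega : t = 1 ∨ t = 2 ∨ (3 ≤ t ∧ k + 1 ≤ t) ∨ (3 ≤ t ∧ ¬ k + 1 ≤ t)) with
      rfl | rfl | ⟨h1, h2⟩ | ⟨h1, h2⟩
    · rw [if_pos (by omega), ← htot, upperRow, if_pos rfl, if_pos rfl]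
      omega
    · rw [if_neg (by omega), if_pos (by omega), one_sub_chi_mul_Sigma a hkn, upperRow, if_pos rfl,
        if_neg (by omega), if_pos rfl]
      push_cast
      rfl
    · have hd := ha.deficit_le (show t - 1 ≤ n by omega)
      rw [if_neg (by omega), if_neg (by omega), if_neg (by omega), if_neg (by omega),
        if_pos (by omega), chi_mul_Sigma a (by omega), show 1 + t - 1 = t by omega, upperRow,
        if_pos rfl, if_neg (by omega), if_neg (by omega)]
      rcases (by omega : t = k + 1 ∨ k + 2 ≤ t) with rfl | h3
      · rw [if_pos rfl, if_neg (by omega)]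
        simp only [Nat.add_sub_cancel] at hd ⊢
        omega
      · rw [if_neg (by omega), if_pos h3]
        omega
    · rw [if_neg (by omega), if_neg (by omega), if_neg (by omega), if_neg (by omega),
        if_neg (by omega), if_neg (by omega), upperRow, if_pos rfl, if_neg (by omega),
        if_neg (by omega), if_neg (by omega), if_neg (by omega)]
      rfl

/-! ### Dyck paths and two-column patterns -/

lemma isDyckPath_row (n : ℕ) : IsDyckPath n 1 fun r => (1, r) :=
  ⟨rfl, rfl, fun _ _ _ => Or.inl rfl⟩

lemma isDyckPath_turn {n r : ℕ} (h2 : 2 ≤ r) (hr : r ≤ n) :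
    IsDyckPath n 2 fun q => if q < r then (1, q + 1) else (2, q) := by
  refine ⟨if_pos (by omega), if_neg (by omega), fun q hq1 hqn => ?_⟩
  dsimp only
  rcases lt_trichotomy (q + 1) r with h | h | h
  · left
    rw [if_pos h, if_pos (by omega)]
  · right
    rw [if_neg (by omega), if_pos (by omega)]
  · left
    rw [if_neg (by omega), if_neg (by omega)]

lemma sum_turn (f g : ℕ → ℕ) {n r : ℕ} (h2 : 2 ≤ r) (hr : r ≤ n) :
    ∑ q ∈ Finset.Icc 1 n, (if q < r then f (q + 1) else g q) =
      ∑ j ∈ Finset.Icc 2 r, f j + ∑ j ∈ Finset.Icc r n, g j := by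
  induction r, h2 using Nat.le_induction with
  | base =>
    rw [sum_Icc_eq_add (by omega), Finset.Icc_self, Finset.sum_singleton]
    simp only [Nat.one_lt_two, if_true]
    congr 1
    refine Finset.sum_congr rfl fun q hq => ?_
    rw [if_neg (by have := Finset.mem_Icc.1 hq; omega)]
  | succ r h2 ih =>
    have h := ih (by omega)
    rw [sum_Icc_eq_add (show r ≤ n by omega) g] at h
    rw [Finset.sum_Icc_succ_top (by omega)]
    -- The two paths differ in the single position `r`.
    have hmem : r ∈ Finset.Icc 1 n := Finset.mem_Icc.2 ⟨by omega, by omega⟩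
    rw [← Finset.add_sum_erase _ _ hmem] at h ⊢
    rw [if_neg (lt_irrefl r)] at h
    rw [if_pos (Nat.lt_succ_self r)]
    have hcongr : ∑ q ∈ (Finset.Icc 1 n).erase r, (if q < r + 1 then f (q + 1) else g q) =
        ∑ q ∈ (Finset.Icc 1 n).erase r, (if q < r then f (q + 1) else g q) := by
      refine Finset.sum_congr rfl fun q hq => ?_
      have hne := Finset.ne_of_mem_erase hq
      split_ifs <;> first | rfl | omega
    rw [hcongr]
    omega

lemma Polytope.isPattern {n i m : ℕ} (hi1 : 1 ≤ i) (hi2 : i ≤ 2) (A : Polytope n i m) :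
    IsPattern n i m A.1 := by
  refine ⟨A.2.1, fun r hir hrn => ?_⟩
  rcases (by omega : i = 1 ∨ i = 2) with rfl | rfl
  · have h := A.2.2 _ (isDyckPath_row n)
    have h0 : ∑ j ∈ Finset.Icc r n, A.1 2 j = 0 :=
      Finset.sum_eq_zero fun j _ => A.2.1 2 j (by omega)
    rw [h0, Nat.add_zero]
    refine (Finset.sum_le_sum_of_subset ?_).trans h
    exact Finset.Icc_subset_Icc le_rfl hrn
  · have h := A.2.2 _ (isDyckPath_turn hir hrn)
    rw [← sum_turn (A.1 1) (A.1 2) hir hrn]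
    refine le_of_eq_of_le (Finset.sum_congr rfl fun q _ => ?_) h
    split_ifs <;> rfl

lemma IsPattern.dyck {n i m : ℕ} {a : Grid} (ha : IsPattern n i m a) (hi1 : 1 ≤ i) (hi2 : i ≤ 2)
    (hin : i ≤ n) {β : ℕ → ℕ × ℕ} (hβ : IsDyckPath n i β) :
    ∑ r ∈ Finset.Icc 1 n, a (β r).1 (β r).2 ≤ m := by
  obtain ⟨hβ1, hβn, hβs⟩ := hβ
  -- A path stays in the first column, or it has changed once, or it is too far to the right.
  have key : ∀ r, 1 ≤ r → r ≤ n →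
      (β r = (1, i + r - 1) ∧ ∑ q ∈ Finset.Icc 1 r, a (β q).1 (β q).2 =
        ∑ j ∈ Finset.Icc i (i + r - 1), a 1 j) ∨
      (∃ t, i ≤ t ∧ t ≤ i + r - 2 ∧ β r = (2, i + r - 2) ∧
        ∑ q ∈ Finset.Icc 1 r, a (β q).1 (β q).2 =
          ∑ j ∈ Finset.Icc i t, a 1 j + ∑ j ∈ Finset.Icc t (i + r - 2), a 2 j) ∨
      2 < (β r).1 := by
    intro r hr
    induction r, hr using Nat.le_induction with
    | base => intro _; left; simp [hβ1]
    | succ r hr ih =>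
      intro hrn
      rcases ih (by omega) with ⟨h1, h2⟩ | ⟨t, ht1, ht2, h1, h2⟩ | h1
      · rcases hβs r hr (by omega) with h | h
        · left
          rw [h1] at h
          have e : i + (r + 1) - 1 = i + r - 1 + 1 := by omega
          refine ⟨by rw [h, e], ?_⟩
          rw [Finset.sum_Icc_succ_top (by omega), h2, h, e, Finset.sum_Icc_succ_top (by omega)]
        · right; left
          rw [h1] at h
          have e : i + (r + 1) - 2 = i + r - 1 := by omega
          refine ⟨i + r - 1, by omega, by omega, by rw [h, e], ?_⟩
          rw [Finset.sum_Icc_succ_top (by omega), h2, h, e, Finset.Icc_self, Finset.sum_singleton]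
      · rcases hβs r hr (by omega) with h | h
        · right; left
          rw [h1] at h
          have e : i + (r + 1) - 2 = i + r - 2 + 1 := by omega
          refine ⟨t, ht1, by omega, by rw [h, e], ?_⟩
          rw [Finset.sum_Icc_succ_top (by omega), h2, h, e, Finset.sum_Icc_succ_top (by omega),
            Nat.add_assoc]
        · right; right
          rw [h, h1]
          exact Nat.lt_succ_self 2
      · right; right
        rcases hβs r hr (by omega) with h | h <;> rw [h] <;> dsimp only <;> omega
  rcases key n (by omega) le_rfl with ⟨h1, h2⟩ | ⟨t, ht1, ht2, h1, h2⟩ | h1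
  · rw [hβn, Prod.mk.injEq] at h1
    rw [h2, ← h1.2]
    exact (Nat.le_add_right _ _).trans (ha.path n hin le_rfl)
  · rw [hβn, Prod.mk.injEq] at h1
    rw [h2, ← h1.2]
    exact ha.path t ht1 (by omega)
  · rw [hβn] at h1
    dsimp only at h1
    omega

/-- A two-column pattern as an element of the polytope. -/
def IsPattern.toPolytope {n i m : ℕ} {a : Grid} (ha : IsPattern n i m a) (hi1 : 1 ≤ i)
    (hi2 : i ≤ 2) (hin : i ≤ n) : Polytope n i m :=
  ⟨a, ha.zero, fun _ hβ => ha.dyck hi1 hi2 hin hβ⟩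

/-! ### The lowering operators on two-column patterns -/

lemma least_eq {S : Finset ℕ} {p : ℕ} (hp : p ∈ S) (h : ∀ q ∈ S, p ≤ q) : least S = p := by
  have : S.min = (p : WithTop ℕ) :=
    le_antisymm (Finset.min_le hp) (Finset.le_min fun q hq => WithTop.coe_le_coe.2 (h q hq))
  rw [least, this]
  rfl

lemma greatest_eq {S : Finset ℕ} {p : ℕ} (hp : p ∈ S) (h : ∀ q ∈ S, q ≤ p) : greatest S = p :=
  le_antisymm (Finset.sup_le h) (Finset.le_sup (f := id) hp)

lemma mem_argmax {S : Finset ℕ} {g : ℕ → ℕ} {p : ℕ} :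
    p ∈ argmax S g ↔ p ∈ S ∧ ∀ q ∈ S, g q ≤ g p :=
  Finset.mem_filter

lemma pPlus_eq_one {i l : ℕ} {b : Grid} (h : i = 1 ∨ i = 2 ∧ b 2 (l - 1) ≤ b 1 l) :
    pPlus i b l = 1 := by
  refine least_eq (mem_argmax.2 ⟨Finset.mem_Icc.2 (by omega), fun q hq => ?_⟩)
    fun q hq => (Finset.mem_Icc.1 (mem_argmax.1 hq).1).1
  rw [Finset.mem_Icc] at hq
  rcases h with rfl | ⟨rfl, h⟩
  · obtain rfl : q = 1 := by omega
    exact le_rfl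
  · rcases (by omega : q = 1 ∨ q = 2) with rfl | rfl
    · exact le_rfl
    · simp [Finset.sum_Icc_succ_top]
      omega

lemma pPlus_eq_two {l : ℕ} {b : Grid} (h : b 1 l < b 2 (l - 1)) : pPlus 2 b l = 2 := by
  refine least_eq (mem_argmax.2 ⟨by simp, fun q hq => ?_⟩) fun q hq => ?_
  · rw [Finset.mem_Icc] at hq
    rcases (by omega : q = 1 ∨ q = 2) with rfl | rfl
    · simp [Finset.sum_Icc_succ_top]
      omega
    · exact le_rfl
  · obtain ⟨hq1, hq2⟩ := mem_argmax.1 hq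
    rw [Finset.mem_Icc] at hq1
    by_contra hlt
    obtain rfl : q = 1 := by omega
    have := hq2 2 (by simp)
    simp [Finset.sum_Icc_succ_top] at this
    omega

lemma fPoly_row_one {n i m l : ℕ} {b : Grid} (hil : i ≤ l)
    (h : i = 1 ∨ i = 2 ∧ b 2 l ≤ b 1 (l + 1)) (hpos : 0 < b 1 l) :
    fPoly n i m (l + 1) b = some (b.move (1, l + 1) (1, l)) := by
  have hp : pPlus i b (l + 1) = 1 := pPlus_eq_one h
  have hphi : phi n i m b (l + 1) = b 1 l := by
    rw [phi, if_neg (by omega), if_neg (by omega), if_pos (by omega), hp]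
    simp
  rw [fPoly, hphi, if_neg (by omega), if_neg (by omega), if_neg (by omega), if_pos (by omega), hp]
  rfl

lemma fPoly_row_two {n m l : ℕ} {b : Grid} (hl : 2 ≤ l) (h : b 1 (l + 1) < b 2 l) :
    fPoly n 2 m (l + 1) b = some (b.move (2, l + 1) (2, l)) := by
  have hp : pPlus 2 b (l + 1) = 2 := pPlus_eq_two h
  have hphi : phi n 2 m b (l + 1) = b 1 l + b 2 l - b 1 (l + 1) := by
    rw [phi, if_neg (by omega), if_neg (by omega), if_pos (by omega), hp]
    simp [Finset.sum_Icc_succ_top]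
  rw [fPoly, hphi, if_neg (by omega), if_neg (by omega), if_neg (by omega), if_pos (by omega), hp]
  rfl

/-- The operator `f_i` acts as soon as the result lies in the polytope. -/
lemma fPoly_self {n i m : ℕ} (hi1 : 1 ≤ i) (hi2 : i ≤ 2) (hin : i ≤ n) {b b' : Grid}
    (hb : IsPattern n i m b') (h : b' = b.set (i, i) (b i i + 1)) :
    fPoly n i m i b = some b' := by
  have hphi : phi n i m b i ≠ 0 := by
    have hrest : ∀ p q, ¬ (p = i ∧ q = i) → b' p q = b p q := by
      intro p q hpq
      rw [h, Grid.set, if_neg (by simpa using hpq)]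
    have hself : b' i i = b i i + 1 := by rw [h, Grid.set, if_pos rfl]
    have hsum : ∑ j ∈ Finset.Icc i n, b' i j = ∑ j ∈ Finset.Icc i n, b i j + 1 := by
      have htail : ∑ j ∈ Finset.Icc (i + 1) n, b' i j = ∑ j ∈ Finset.Icc (i + 1) n, b i j :=
        Finset.sum_congr rfl fun j hj => hrest i j (by have := Finset.mem_Icc.1 hj; omega)
      rw [sum_Icc_eq_add hin (b' i), sum_Icc_eq_add hin (b i), hself, htail]
      omega
    rw [phi, if_neg (by omega), if_pos rfl, ← Nat.cast_sum, ← Nat.cast_sum]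
    rcases (by omega : i = 1 ∨ i = 2) with rfl | rfl
    · have := hb.path n hin le_rfl
      rw [hsum] at this
      rw [show Finset.Icc 1 (1 - 1) = ∅ from rfl, Finset.sum_empty]
      omega
    · have := hb.path 2 le_rfl hin
      rw [hsum, Finset.Icc_self, Finset.sum_singleton, hrest 1 2 (by omega)] at this
      rw [show Finset.Icc 1 (2 - 1) = {1} from rfl, Finset.sum_singleton]
      omega
  rw [fPoly, if_neg hphi, if_neg (by omega), if_pos rfl, h]

/-- The pattern with the entries `s` and `t` in row `i` and zeros elsewhere. -/
def corner (i s t : ℕ) : Grid := fun p q =>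
  if q = i then (if p = 1 then s else if p = 2 then t else 0) else 0

lemma isPattern_corner {n i m s t : ℕ} (hi1 : 1 ≤ i) (hi2 : i ≤ 2) (hin : i ≤ n) (h : s + t ≤ m)
    (ht : i = 1 → t = 0) : IsPattern n i m (corner i s t) := by
  refine ⟨fun p q hpq => ?_, fun r hr hrn => ?_⟩
  · rw [corner]
    split_ifs <;> omega
  · simp only [corner, if_true]
    rw [if_neg (by omega : ¬ 2 = 1), Finset.sum_ite_eq', Finset.sum_ite_eq']
    split_ifs <;> omega

lemma fPoly_one_corner {n m s t : ℕ} (hn : 2 ≤ n) :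
    fPoly n 2 m 1 (corner 2 s (t + 1)) = some (corner 2 (s + 1) t) := by
  have hsum1 : ∀ p, 2 ≤ p → ∑ j ∈ Finset.Icc 2 p, corner 2 s (t + 1) 1 j = s := by
    intro p hp
    simp [corner, hp]
  have hsum2 : ∀ p, ∑ j ∈ Finset.Icc p n, corner 2 s (t + 1) 2 j = if p ≤ 2 then t + 1 else 0 := by
    intro p
    simp [corner, hn]
  have hp : pMinus n 2 (corner 2 s (t + 1)) 1 = 2 := by
    refine greatest_eq (mem_argmax.2 ⟨Finset.mem_Icc.2 ⟨le_rfl, hn⟩, fun q hq => ?_⟩) fun q hq => ?_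
    · rw [hsum1 q (Finset.mem_Icc.1 hq).1, hsum1 2 le_rfl, hsum2, hsum2]
      split_ifs <;> omega
    · obtain ⟨hq1, hq2⟩ := mem_argmax.1 hq
      have := hq2 2 (Finset.mem_Icc.2 ⟨le_rfl, hn⟩)
      rw [hsum1 q (Finset.mem_Icc.1 hq1).1, hsum1 2 le_rfl, hsum2, hsum2] at this
      split_ifs at this <;> omega
  have hphi : phi n 2 m (corner 2 s (t + 1)) 1 = t + 1 := by
    rw [phi, if_neg (by omega), if_neg (by omega), if_neg (by omega), hp]
    have h3 : ∑ j ∈ Finset.Icc (2 + 1) n, corner 2 s (t + 1) 1 j = 0 :=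
      Finset.sum_eq_zero fun j hj => by
        rw [corner, if_neg (by have := Finset.mem_Icc.1 hj; omega)]
    rw [← Nat.cast_sum, ← Nat.cast_sum, h3, hsum2]
    simp
  rw [fPoly, hphi, if_neg (by omega), if_neg (by omega), if_neg (by omega), if_neg (by omega), hp]
  congr 1
  funext p q
  simp only [Grid.move, Grid.set, corner, Prod.mk.injEq]
  split_ifs <;> omega

/-- The patterns on the way from `X(i)_{k+1} ⋯ X(i)_n G(i) 0` to `X(i)_k ⋯ X(i)_n G(i) 0`. The rows
below `k` have their final entries, the entries `x₁, x₂` in row `l + 1` and `y₁, y₂` in row `l`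
are on their way to row `k`, and what is needed for the rows above `k` waits in position
`(1, i)`. -/
def walk (i : ℕ) (a : Grid) (k l y₁ y₂ x₁ x₂ : ℕ) : Grid := fun p q =>
  (if p = 1 ∧ q = i then ∑ j ∈ Finset.Icc i (k - 1), a 1 j else 0)
    + (if k < q then a p q else 0)
    + (if q = l then (if p = 1 then y₁ else if p = 2 then y₂ else 0) else 0)
    + if q = l + 1 then (if p = 1 then x₁ else if p = 2 then x₂ else 0) else 0

lemma sum_Icc_tail_add {i k r : ℕ} (hik : i ≤ k) (hir : i ≤ r) (f : ℕ → ℕ) :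
    ∑ q ∈ Finset.Icc i r, (if k < q then f q else 0) + ∑ q ∈ Finset.Icc i k, f q =
      ∑ q ∈ Finset.Icc i (max r k), f q := by
  induction r, hir using Nat.le_induction with
  | base => simp [hik]
  | succ r hir ih =>
    rw [Finset.sum_Icc_succ_top (by omega)]
    rcases lt_or_ge k (r + 1) with h | h
    · rw [if_pos h, max_eq_left h.le, Finset.sum_Icc_succ_top (by omega)]
      rw [max_eq_left (by omega)] at ih
      omega
    · rw [if_neg (by omega), max_eq_right h]
      rw [max_eq_right (by omega)] at ih
      omega

lemma IsPattern.walk {n i m : ℕ} {a : Grid} (ha : IsPattern n i m a) (hi1 : 1 ≤ i) (hi2 : i ≤ 2)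
    {k l y₁ y₂ x₁ x₂ : ℕ} (hkn : k ≤ n) (hil : i ≤ l) (hlk : l ≤ k)
    (hx : l < k ∨ x₁ = 0 ∧ x₂ = 0) (h1 : y₁ + x₁ = a 1 k) (h2 : y₂ + x₂ ≤ a 2 k) :
    IsPattern n i m (walk i a k l y₁ y₂ x₁ x₂) := by
  refine ⟨fun p q hpq => ?_, fun r hr hrn => ?_⟩
  · have h0 : i = 1 → y₂ = 0 ∧ x₂ = 0 := by
      intro h
      have := ha.zero 2 k (by omega)
      omega
    rw [KRCrystal.walk, ha.zero p q hpq]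
    split_ifs <;> omega
  · have hw1 : ∀ q, KRCrystal.walk i a k l y₁ y₂ x₁ x₂ 1 q =
        (if q = i then ∑ j ∈ Finset.Icc i (k - 1), a 1 j else 0) + (if k < q then a 1 q else 0)
          + (if q = l then y₁ else 0) + if q = l + 1 then x₁ else 0 := by
      intro q
      simp [KRCrystal.walk]
    have hw2 : ∀ q, KRCrystal.walk i a k l y₁ y₂ x₁ x₂ 2 q =
        (if k < q then a 2 q else 0) + (if q = l then y₂ else 0) + if q = l + 1 then x₂ else 0 := by
      intro q
      simp [KRCrystal.walk]
    have hs1 : ∑ q ∈ Finset.Icc i r, KRCrystal.walk i a k l y₁ y₂ x₁ x₂ 1 q ≤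
        ∑ q ∈ Finset.Icc i (max r k), a 1 q := by
      rw [← sum_Icc_tail_add (hil.trans hlk) hr, sum_Icc_pred_add (by omega) (hil.trans hlk)]
      simp only [hw1, Finset.sum_add_distrib, Finset.sum_ite_eq']
      split_ifs <;> omega
    have hs2 : ∑ q ∈ Finset.Icc r n, KRCrystal.walk i a k l y₁ y₂ x₁ x₂ 2 q ≤
        ∑ q ∈ Finset.Icc (max r k) n, a 2 q := by
      have htail : ∑ q ∈ Finset.Icc r n, (if k < q then a 2 q else 0) ≤
          ∑ q ∈ Finset.Icc (max r (k + 1)) n, a 2 q := by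
        rw [← Finset.sum_filter]
        refine Finset.sum_le_sum_of_subset fun q hq => ?_
        simp only [Finset.mem_filter, Finset.mem_Icc] at hq ⊢
        omega
      simp only [hw2, Finset.sum_add_distrib, Finset.sum_ite_eq', Finset.mem_Icc]
      rcases le_or_gt r k with h | h
      · rw [max_eq_right (by omega)] at htail
        rw [max_eq_right h, sum_Icc_eq_add hkn]
        split_ifs <;> omega
      · rw [max_eq_left (by omega)] at htail
        rw [max_eq_left h.le]
        split_ifs <;> omega
    exact (Nat.add_le_add hs1 hs2).trans (ha.path _ (by omega) (by omega))

lemma walk_succ_eq {n i m : ℕ} {a : Grid} (ha : IsPattern n i m a) (hi2 : i ≤ 2) {k : ℕ}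
    (hk : 1 ≤ k) (hik : i ≤ k) :
    walk i a (k + 1) (k + 1) (a 1 (k + 1)) (a 2 (k + 1)) 0 0 = walk i a k i (a 1 k) 0 0 0 := by
  have hs := sum_Icc_pred_add hk hik (a 1)
  funext p q
  rcases eq_or_ne q (k + 1) with rfl | hq
  · have h0 : p ≠ 1 → p ≠ 2 → a p (k + 1) = 0 := fun h1 h2 =>
      ha.zero _ _ (by omega)
    simp only [walk, Nat.add_sub_cancel]
    split_ifs <;> subst_vars <;> omega
  · simp only [walk, Nat.add_sub_cancel]
    split_ifs <;> omega

lemma walk_two_eq {n i m : ℕ} {a : Grid} (ha : IsPattern n i m a) (hi1 : 1 ≤ i) (hi2 : i ≤ 2)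
    (hn : 2 ≤ n) : walk i a 2 2 (a 1 2) (a 2 2) 0 0 = a := by
  funext p q
  by_cases hpq : 1 ≤ p ∧ p ≤ i ∧ i ≤ q ∧ q ≤ n
  · rcases (by omega : i = 1 ∨ i = 2) with rfl | rfl
    · obtain rfl : p = 1 := by omega
      rcases (by omega : q = 1 ∨ q = 2 ∨ 2 < q) with rfl | rfl | h
      · simp [walk]
      · simp [walk]
      · simp [walk, h, show q ≠ 1 by omega, show q ≠ 2 by omega]
    · rcases (by omega : p = 1 ∨ p = 2) with rfl | rfl <;>
        rcases (by omega : q = 2 ∨ 2 < q) with rfl | h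
      · simp [walk]
      · simp [walk, h, show q ≠ 2 by omega]
      · simp [walk]
      · simp [walk, h, show q ≠ 2 by omega]
  · have h0 := ha.zero p q hpq
    rcases (by omega : i = 1 ∨ i = 2) with rfl | rfl
    · rcases eq_or_ne q 2 with rfl | hq
      · have := ha.zero 2 2 (by omega)
        simp only [walk]
        split_ifs <;> subst_vars <;> omega
      · simp only [walk, h0]
        split_ifs <;> omega
    · rcases eq_or_ne q 2 with rfl | hq
      · simp only [walk]
        split_ifs <;> subst_vars <;> omega
      · simp only [walk, h0]
        split_ifs <;> omega

lemma walk_start_eq {n i m : ℕ} {a : Grid} (ha : IsPattern n i m a) :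
    walk i a (n + 1) (n + 1) (a 1 (n + 1)) (a 2 (n + 1)) 0 0 = corner i (total n i a) 0 := by
  have h1 := ha.zero 1 (n + 1) (by omega)
  have h2 := ha.zero 2 (n + 1) (by omega)
  funext p q
  simp only [walk, corner, Nat.add_sub_cancel, h1, h2, total]
  by_cases hq : n + 1 < q
  · rw [ha.zero p q (by omega)]
    split_ifs <;> omega
  · split_ifs <;> omega

/-! ### Paths in the polytope and their images -/

/-- There is an arrow of a colour `l ∈ {1, …, n}` from `C` to `C'`. -/
def Arrow {n i m : ℕ} (C C' : Polytope n i m) : Prop :=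
  ∃ l, 1 ≤ l ∧ l ≤ n ∧ fPoly n i m l C.1 = some C'.1

/-- The pattern `b` lies in the polytope, it can be reached from `Z` along arrows of the colours
`1, …, n`, and `y` is its image under `Φ`. -/
def Follows {n i m : ℕ} (Φ : Polytope n i m → Tableau n i m) (Z : Polytope n i m) (b : Grid)
    (y : Option Grid) : Prop :=
  ∃ C : Polytope n i m, C.1 = b ∧ Relation.ReflTransGen Arrow Z C ∧ y = some (Φ C).entries

lemma Follows.fPow_apply {n i m : ℕ} {Φ : Polytope n i m → Tableau n i m}
    (hΦ : IsAffineCrystalIso n i m Φ) (hi1 : 1 ≤ i) (hi2 : i ≤ 2) (hin : i ≤ n)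
    {Z : Polytope n i m} {l : ℕ} (hl1 : 1 ≤ l) (hln : l ≤ n) {b : ℕ → Grid} {d : ℕ}
    {y : Option Grid} (h : Follows Φ Z (b 0) y)
    (hstep : ∀ t < d, fPoly n i m l (b t) = some (b (t + 1)))
    (hb : ∀ t ≤ d, IsPattern n i m (b t)) :
    Follows Φ Z (b d) (fPow n i m l d y) := by
  induction d with
  | zero => exact h
  | succ d ih =>
    obtain ⟨C, hC, hreach, hy⟩ := ih (fun t ht => hstep t (by omega)) fun t ht => hb t (by omega)
    have harrow : fPoly n i m l C.1 =
        some ((hb (d + 1) le_rfl).toPolytope hi1 hi2 hin).1 := by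
      rw [hC]
      exact hstep d (Nat.lt_succ_self d)
    refine ⟨(hb (d + 1) le_rfl).toPolytope hi1 hi2 hin, rfl,
      hreach.tail ⟨l, hl1, hln, harrow⟩, ?_⟩
    rw [fPow_succ, hy, Option.bind_some]
    exact (hΦ.map_f l hln _ _).1 harrow

lemma fPoly_corner_self {n i m s : ℕ} (hi1 : 1 ≤ i) (hi2 : i ≤ 2) (hin : i ≤ n) (h : s + 1 ≤ m) :
    fPoly n i m i (if i = 1 then corner i s 0 else corner i 0 s) =
      some (if i = 1 then corner i (s + 1) 0 else corner i 0 (s + 1)) := by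
  refine fPoly_self hi1 hi2 hin ?_ ?_
  · split_ifs
    · exact isPattern_corner hi1 hi2 hin (by omega) fun _ => rfl
    · exact isPattern_corner hi1 hi2 hin (by omega) (by omega)
  · rcases (by omega : i = 1 ∨ i = 2) with rfl | rfl
    · funext p q
      simp only [if_true, corner, Grid.set, Prod.mk.injEq]
      split_ifs <;> omega
    · funext p q
      simp only [show ¬ 2 = 1 by omega, if_false, corner, Grid.set, Prod.mk.injEq]
      split_ifs <;> omega

/-- The product `G(i)^A` takes the zero pattern to the one whose only entry is the total
`∑_{r=i}^n a_{1,r}` in position `(1, i)`. -/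
lemma Follows.G_apply {n i m : ℕ} {Φ : Polytope n i m → Tableau n i m}
    (hΦ : IsAffineCrystalIso n i m Φ) (hi1 : 1 ≤ i) (hi2 : i ≤ 2) (hin : i ≤ n)
    {Z : Polytope n i m} {a : Grid} (ha : IsPattern n i m a) {y : Option Grid}
    (h : Follows Φ Z (corner i 0 0) y) :
    Follows Φ Z (corner i (total n i a) 0) (G n i m a y) := by
  have hm := ha.total_le hin
  have hself := Follows.fPow_apply hΦ hi1 hi2 hin hi1 hin (d := total n i a)
    (b := fun t => if i = 1 then corner i t 0 else corner i 0 t) (by simpa using h)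
    (fun t ht => fPoly_corner_self hi1 hi2 hin (by omega)) fun t ht => by
      split_ifs
      · exact isPattern_corner hi1 hi2 hin (by omega) fun _ => rfl
      · exact isPattern_corner hi1 hi2 hin (by omega) (by omega)
  rcases (by omega : i = 1 ∨ i = 2) with rfl | rfl
  · rw [G_one]
    exact hself
  · rw [G_two]
    have hone := Follows.fPow_apply hΦ hi1 hi2 hin le_rfl (by omega) (d := total n 2 a)
      (b := fun t => corner 2 t (total n 2 a - t)) hself
      (fun t ht => by
        have := fPoly_one_corner (m := m) (s := t) (t := total n 2 a - (t + 1)) hin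
        rwa [show total n 2 a - (t + 1) + 1 = total n 2 a - t by omega] at this)
      fun t ht => isPattern_corner hi1 hi2 hin (by omega) (by omega)
    simpa using hone

lemma fPoly_walk_self {n m : ℕ} {a : Grid} (ha : IsPattern n 2 m a) {k t : ℕ} (hk : 2 ≤ k)
    (hkn : k ≤ n) (ht : t + 1 ≤ a 2 k) :
    fPoly n 2 m 2 (walk 2 a k 2 (a 1 k) t 0 0) = some (walk 2 a k 2 (a 1 k) (t + 1) 0 0) := by
  refine fPoly_self (by omega) le_rfl (by omega)
    (ha.walk (by omega) le_rfl hkn le_rfl hk (Or.inr ⟨rfl, rfl⟩) rfl ht) ?_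
  funext p q
  by_cases h : p = 2 ∧ q = 2
  · obtain ⟨rfl, rfl⟩ := h
    simp [walk, Grid.set, hk.not_gt]
  · rw [Grid.set, if_neg (by simpa using h)]
    rcases eq_or_ne q 2 with rfl | hq
    · simp [walk, show p ≠ 2 by omega]
    · simp [walk, hq]

/-- A step of `f_{l+1}` in the second column. -/
lemma fPoly_walk_two {n m : ℕ} {a : Grid} {k l y₁ y₂ x₂ : ℕ} (hl : 2 ≤ l) (hlk : l < k) :
    fPoly n 2 m (l + 1) (walk 2 a k l y₁ (y₂ + 1) 0 x₂) =
      some (walk 2 a k l y₁ y₂ 0 (x₂ + 1)) := by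
  rw [fPoly_row_two hl]
  · congr 1
    funext p q
    rcases eq_or_ne p 2 with rfl | hp
    · rcases eq_or_ne q l with rfl | hq
      · simp [walk, Grid.move, Grid.set, hlk.not_gt]
      · rcases eq_or_ne q (l + 1) with rfl | hq'
        · simp [walk, Grid.move, Grid.set, show ¬ k < l + 1 by omega]
        · simp [walk, Grid.move, Grid.set, hq, hq']
    · simp [walk, Grid.move, Grid.set, hp]
  · simp [walk, hlk.not_gt, show ¬ k < l + 1 by omega, show l + 1 ≠ 2 by omega]

/-- A step of `f_{l+1}` in the first column, when nothing is left to be moved in the second. -/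
lemma fPoly_walk_one {n i m : ℕ} {a : Grid} (hi1 : 1 ≤ i) (hi2 : i ≤ 2) {k l y₁ x₁ x₂ : ℕ}
    (hl : i ≤ l) (hlk : l < k) :
    fPoly n i m (l + 1) (walk i a k l (y₁ + 1) 0 x₁ x₂) =
      some (walk i a k l y₁ 0 (x₁ + 1) x₂) := by
  rw [fPoly_row_one hl]
  · congr 1
    funext p q
    rcases eq_or_ne p 1 with rfl | hp
    · rcases eq_or_ne q l with rfl | hq
      · simp [walk, Grid.move, Grid.set, hlk.not_gt]
      · rcases eq_or_ne q (l + 1) with rfl | hq'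
        · simp [walk, Grid.move, Grid.set, show ¬ k < l + 1 by omega, Nat.add_assoc]
        · simp [walk, Grid.move, Grid.set, hq, hq']
    · simp [walk, Grid.move, Grid.set, hp]
  · rcases (by omega : i = 1 ∨ i = 2) with rfl | rfl
    · exact Or.inl rfl
    · right
      simp [walk, hlk.not_gt]
  · simp [walk, hlk.not_gt]

lemma walk_next_eq (i : ℕ) (a : Grid) (k l x₁ x₂ : ℕ) :
    walk i a k l 0 0 x₁ x₂ = walk i a k (l + 1) x₁ x₂ 0 0 := by
  funext p q
  simp only [walk]
  split_ifs <;> omega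

/-- In the polytope, `X(i)_k` brings the entries of row `k` into place. -/
lemma Follows.X_apply {n i m : ℕ} {Φ : Polytope n i m → Tableau n i m}
    (hΦ : IsAffineCrystalIso n i m Φ) (hi1 : 1 ≤ i) (hi2 : i ≤ 2) {Z : Polytope n i m} {a : Grid}
    (ha : IsPattern n i m a) {k : ℕ} (hk : 2 ≤ k) (hkn : k ≤ n) {y : Option Grid}
    (h : Follows Φ Z (walk i a (k + 1) (k + 1) (a 1 (k + 1)) (a 2 (k + 1)) 0 0) y) :
    Follows Φ Z (walk i a k k (a 1 k) (a 2 k) 0 0) (X n i m a k y) := by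
  refine ha.X_induction hi1 hi2 hk (P := fun l => Follows Φ Z (walk i a k l (a 1 k) (a 2 k) 0 0))
    ?_ ?_
  · rw [walk_succ_eq ha hi2 (by omega) (by omega)] at h
    refine Follows.fPow_apply hΦ hi1 hi2 (by omega) hi1 (by omega)
      (b := fun t => walk i a k i (a 1 k) t 0 0) h (fun t ht => ?_) fun t ht =>
        ha.walk hi1 hi2 hkn le_rfl (by omega) (Or.inr ⟨rfl, rfl⟩) rfl ht
    rcases (by omega : i = 1 ∨ i = 2) with rfl | rfl
    · have := ha.zero 2 k (by omega)
      omega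
    · exact fPoly_walk_self ha hk hkn ht
  · intro l hl hlk y hy
    -- The entry in the second column is moved before the one in the first column.
    have hmove := Follows.fPow_apply hΦ hi1 hi2 (by omega) (show 1 ≤ l + 1 by omega)
      (show l + 1 ≤ n by omega) (d := a 1 k + a 2 k)
      (b := fun t => walk i a k l (a 1 k - (t - a 2 k)) (a 2 k - t) (t - a 2 k) (min t (a 2 k)))
      (by simpa using hy) (fun t ht => ?_) fun t ht =>
        ha.walk hi1 hi2 hkn hl hlk.le (Or.inl hlk) (by omega) (by omega)
    · simpa [walk_next_eq] using hmove
    · rcases lt_or_ge t (a 2 k) with h2 | h2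
      · obtain rfl : i = 2 := by
          by_contra hne
          have := ha.zero 2 k (by omega)
          omega
        have hs := fPoly_walk_two (n := n) (m := m) (a := a) (y₁ := a 1 k)
          (y₂ := a 2 k - (t + 1)) (x₂ := t) hl hlk
        simpa [show t - a 2 k = 0 by omega, show t + 1 - a 2 k = 0 by omega, h2.le,
          show a 2 k - (t + 1) + 1 = a 2 k - t by omega, Nat.succ_le_of_lt h2] using hs
      · have hs := fPoly_walk_one (n := n) (m := m) (a := a) (y₁ := a 1 k - (t + 1 - a 2 k))
          (x₁ := t - a 2 k) (x₂ := a 2 k) hi1 hi2 hl hlk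
        simpa [show a 2 k - t = 0 by omega, show a 2 k - (t + 1) = 0 by omega, h2,
          show a 2 k ≤ t + 1 by omega, show t - a 2 k + 1 = t + 1 - a 2 k by omega,
          show a 1 k - (t + 1 - a 2 k) + 1 = a 1 k - (t - a 2 k) by omega] using hs

/-- The path `P(i)^A` leads from the zero pattern to `A`. -/
lemma Follows.path_apply {n i m : ℕ} {Φ : Polytope n i m → Tableau n i m}
    (hΦ : IsAffineCrystalIso n i m Φ) (hi1 : 1 ≤ i) (hi2 : i ≤ 2) (hn : 2 ≤ n)
    {Z : Polytope n i m} {a : Grid} (ha : IsPattern n i m a) {y : Option Grid}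
    (h : Follows Φ Z (corner i 0 0) y) :
    Follows Φ Z a (prodOp 2 n (X n i m a) (G n i m a y)) := by
  have hG := Follows.G_apply hΦ hi1 hi2 (by omega) ha h
  rw [← walk_start_eq ha] at hG
  have hX := prodOp_induction
    (P := fun k => Follows Φ Z (walk i a k k (a 1 k) (a 2 k) 0 0)) (F := X n i m a)
    (show 2 ≤ n + 1 by omega) hG
    fun k hk hkn y hy => Follows.X_apply hΦ hi1 hi2 ha hk hkn hy
  simpa only [walk_two_eq ha hi1 hi2 hn] using hX

/-! ### The image of the zero pattern -/

lemma mem_foldl_pairStep {j : ℕ} {T : Grid} (ps : List (ℕ × ℕ))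
    (st : List (ℕ × ℕ) × List (ℕ × ℕ)) (h : ∀ q ∈ st.1, T q.1 q.2 = j) :
    ∀ q ∈ (ps.foldl (pairStep j T) st).1, T q.1 q.2 = j := by
  induction ps generalizing st with
  | nil => exact h
  | cons p ps ih =>
    refine ih _ fun q hq => ?_
    unfold pairStep at hq
    split_ifs at hq with h1 h2
    · exact h q hq
    · split at hq
      · rcases List.mem_cons.1 hq with rfl | hq
        · exact h2
        · exact h q hq
      · exact h q hq
    · exact h q hq

/-- No arrow of a colour `l ≥ 1` ends at the highest weight tableau. -/
lemma fTab_ne_highestTableau {n i m l : ℕ} (hl : 1 ≤ l) (T : Tableau n i m) :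
    fTab n i m l T.entries ≠ some (highestTableau i m) := by
  intro h
  rw [fTab, if_neg (by omega), fSig, Option.map_eq_some_iff] at h
  obtain ⟨⟨r, c⟩, hp, hset⟩ := h
  have hT : T.entries r c = l :=
    mem_foldl_pairStep (j := l) (T := T.entries) (readingOrder i m) ([], []) (by simp) _
      (List.mem_of_mem_head? hp)
  have hrc : r < i ∧ c < m := by
    by_contra hrc
    have : T.entries r c = 0 := T.1.zeros (by rwa [mem_rect])
    omega
  have h1 := congrFun (congrFun hset r) c
  rw [Grid.set, if_pos rfl, highestTableau, if_pos hrc] at h1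
  -- The entry `l` stands in row `l`, below another entry `l`.
  have h2 := congrFun (congrFun hset (r - 1)) c
  rw [Grid.set, if_neg (by rw [Prod.mk.injEq]; omega), highestTableau, if_pos (by omega)] at h2
  have h3 := T.col_strict (show r - 1 < r by omega) hrc.1 hrc.2
  omega

lemma Tableau.ext_entries {n i m : ℕ} {T T' : Tableau n i m} (h : T.entries = T'.entries) :
    T = T' :=
  Subtype.ext (SemistandardYoungTableau.ext fun r c => congrFun (congrFun h r) c)

/-- An affine crystal isomorphism takes the zero pattern to the highest weight tableau. -/
lemma IsAffineCrystalIso.map_zero {n i m : ℕ} {Φ : Polytope n i m → Tableau n i m}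
    (hΦ : IsAffineCrystalIso n i m Φ) (hi1 : 1 ≤ i) (hi2 : i ≤ 2) (hn : 2 ≤ n)
    {Z : Polytope n i m} (hZ : Z.1 = corner i 0 0) : (Φ Z).entries = highestTableau i m := by
  obtain ⟨B, hB⟩ := hΦ.bijective.2 (highest n i m (by omega))
  obtain ⟨C, hC, hreach, -⟩ := Follows.path_apply hΦ hi1 hi2 hn (B.isPattern hi1 hi2)
    (⟨Z, hZ, Relation.ReflTransGen.refl, rfl⟩ : Follows Φ Z _ (some (Φ Z).entries))
  obtain rfl : C = B := Subtype.ext hC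
  -- Every pattern is reached from the zero pattern, but no arrow ends at the highest weight.
  rcases hreach.cases_tail with rfl | ⟨D, -, l, hl1, hln, hD⟩
  · rw [hB, highest_entries]
  · have := (hΦ.map_f l hln D C).1 hD
    rw [hB, highest_entries] at this
    exact absurd this (fTab_ne_highestTableau hl1 (Φ D))

lemma IsAffineCrystalIso.pathTableau_eq {n i m : ℕ} {Φ : Polytope n i m → Tableau n i m}
    (hΦ : IsAffineCrystalIso n i m Φ) (hi1 : 1 ≤ i) (hi2 : i ≤ 2) (hn : 2 ≤ n)
    (A : Polytope n i m) : pathTableau n i m A.1 = some (Φ A).entries := by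
  let Z : Polytope n i m :=
    (isPattern_corner hi1 hi2 (by omega) (Nat.zero_le m) fun _ => rfl :
      IsPattern n i m (corner i 0 0)).toPolytope hi1 hi2 (by omega)
  obtain ⟨C, hC, -, hy⟩ := Follows.path_apply hΦ hi1 hi2 hn (A.isPattern hi1 hi2)
    (⟨Z, rfl, Relation.ReflTransGen.refl, rfl⟩ : Follows Φ Z _ (some (Φ Z).entries))
  obtain rfl : C = A := Subtype.ext hC
  rw [hΦ.map_zero hi1 hi2 hn (Z := Z) rfl] at hy
  exact hy

end KRCrystal

theorem theorem4p3 (n i m : ℕ) (hn : 4 ≤ n) (hi1 : 1 ≤ i) (hi2 : i ≤ 2) (hm : 1 ≤ m)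
    (A : KRCrystal.Polytope n i m) :
    (∀ k, 2 ≤ k → k ≤ n →
      ∃ T : KRCrystal.Tableau n i m,
        KRCrystal.partialTableau n i m A.1 k = some T.entries ∧
        ∀ s ∈ Finset.Icc 1 i, ∀ t ∈ Finset.Icc 1 (n + 2 - i),
          (KRCrystal.mult m T.entries s t : ℤ) = KRCrystal.entryFormula n i m A.1 k s t) ∧
    (∃ T : KRCrystal.Tableau n i m,
      KRCrystal.pathTableau n i m A.1 = some T.entries ∧
      (∀ s ∈ Finset.Icc 1 i, ∀ t ∈ Finset.Icc 1 (n + 2 - i),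
        (KRCrystal.mult m T.entries s t : ℤ) = KRCrystal.entryFormula n i m A.1 2 s t) ∧
      ∀ Φ : KRCrystal.Polytope n i m → KRCrystal.Tableau n i m,
        KRCrystal.IsAffineCrystalIso n i m Φ → Φ A = T) := by
  have ha := A.isPattern hi1 hi2
  obtain ⟨T, hT, hmult⟩ := ha.exists_partialTableau hi1 hi2 le_rfl (by omega : 2 ≤ n)
  exact ⟨fun k hk hkn => ha.exists_partialTableau hi1 hi2 hk hkn, T, hT, hmult,
    fun Φ hΦ => KRCrystal.Tableau.ext_entries (Option.some.inj
      ((hΦ.pathTableau_eq hi1 hi2 (by omega) A).symm.trans hT))⟩
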